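/- For a locally integrable function $w$ on $\mathbb{R}^3$ put $$\|w\|_{\mathcal F}:=\sup_{Q}\Big(\int_Q|w(x)|\,dx\Big)^{-1}\int_Q\int_Q\frac{|w(x)w(y)|}{|x-y|}\,dx\,dy,$$ where the supremum is over all dyadic cubes $Q=\prod_{i=1}^3[2^k m_i,2^k(m_i+1))$, $k\in\mathbb{Z}$, $m\in\mathbb{Z}^3$ (cubes with $\int_Q|w|=0$ contribute $0$), and let $\mathcal F(\mathbb{R}^3)$ be the class of locally integrable real-valued $w$ with $\|w\|_{\mathcal F}<\infty$. Let $a\in C^\infty(\mathbb{R}^3\times\mathbb{R}^3)$ be complex-valued, bounded together with each of its partial derivatives of every order, with $$\operatorname{supp}a\subset\{(x,y)\in\mathbb{R}^3\times\mathbb{R}^3:\ 1/2\le|x-y|\le2\}.$$ Then there is a constant $C$, depending only on $a$, such that for every $w\in\mathcal F(\mathbb{R}^3)$ with $w\ge0$, every complex-valued $f\in L^2(\mathbb{R}^3)$ and every $\lambda\in\mathbb{R}$ with $|\lambda|\ge1$, the integral $\int_{\mathbb{R}^3}e^{i\lambda|x-y|}a(x,y)f(y)\,dy$ converges absolutely for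 every $x$, defines a function of $x$ in $L^2(\mathbb{R}^3,w\,dx)$, and satisfies $$\Big\|\int_{\mathbb{R}^3}e^{i\lambda|x-y|}a(x,y)f(y)\,dy\Big\|_{L^2(\mathbb{R}^3,\,w\,dx)}\le C\,|\lambda|^{-1/2}\,\|w\|_{\mathcal F}^{1/2}\,\|f\|_{L^2(\mathbb{R}^3)}.$$ -/

import Mathlib

open MeasureTheory
open scoped ENNReal NNReal ContDiff

/-- Euclidean three-space, with the Euclidean norm. -/
abbrev R3 : Type := EuclideanSpace ℝ (Fin 3)

/-- The half-open dyadic cube of side length `2 ^ k` with lower corner `2 ^ k • m`. -/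
def dyadicCube (k : ℤ) (m : Fin 3 → ℤ) : Set R3 :=
  {x | ∀ i, (2 : ℝ) ^ k * (m i : ℝ) ≤ x i ∧ x i < (2 : ℝ) ^ k * ((m i : ℝ) + 1)}

/-- The norm of the class `F`: the supremum over all dyadic cubes `Q` of
`(∫_Q |w|)⁻¹ ∫_Q ∫_Q |w(x) w(y)| / |x - y| dx dy`. A cube with `∫_Q |w| = 0` contributes `0`
(its double integral vanishes); `∫_Q |w| = ∞` does not occur for locally integrable `w`. -/
noncomputable def classFNorm (w : R3 → ℝ) : ℝ≥0∞ :=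
  ⨆ (k : ℤ) (m : Fin 3 → ℤ),
    (∫⁻ x in dyadicCube k m, ‖w x‖ₑ)⁻¹ *
      ∫⁻ x in dyadicCube k m, ∫⁻ y in dyadicCube k m, ‖w x‖ₑ * ‖w y‖ₑ / ‖x - y‖ₑ

/-- Membership in the class `F`: locally integrable with finite norm. -/
structure MemClassF (w : R3 → ℝ) : Prop where
  locallyIntegrable : LocallyIntegrable w volume
  norm_lt_top : classFNorm w < ⊤

/-- The weighted measure `w(x) dx`. -/
noncomputable def weightMeasure (w : R3 → ℝ) : Measure R3 :=
  volume.withDensity fun x => ENNReal.ofReal (w x)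

/-- The integrand `y ↦ e^{i lam |x - y|} a(x, y) f(y)`. -/
noncomputable def oscIntegrand (lam : ℝ) (a : R3 × R3 → ℂ) (f : R3 → ℂ) (x y : R3) : ℂ :=
  Complex.exp (Complex.I * ((lam * ‖x - y‖ : ℝ) : ℂ)) * a (x, y) * f y

/-- The oscillatory integral operator `f ↦ ∫ e^{i lam |x - y|} a(x, y) f(y) dy`. -/
noncomputable def oscIntegral (lam : ℝ) (a : R3 × R3 → ℂ) (f : R3 → ℂ) (x : R3) : ℂ :=
  ∫ y, oscIntegrand lam a f x y

/-! ### Dyadic cubes -/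

/-! Write T for the operator and μ = w dx. The proof is a T T* argument in which the kernel of T T*
is dominated by the Coulomb kernel.

Oscillation. That kernel is ∫ e^{iλ(|x-y|-|z-y|)} a(x,y) conj a(z,y) dy. In spherical coordinates
centred at x with axis through z, the phase |x-y| is the radius u. The other distance v satisfies v
dv = u r sin θ dθ with r = |x-z|, so the Jacobian sin θ cancels the degeneracy of the phase at the
poles. One integration by parts in θ then gives the bound C / (|λ| |x-z|) (`norm_osc_kernel_le`).

Trace inequality. It remains to show ∬ g(x) g(z) / |x-z| dμ dμ ≤ C ‖w‖_F ∫ g² dμ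
(`trace_inequality`). The energy of ν = g μ is at most a constant times the sum over dyadic Q of
ν(Q)² / ℓ(Q) (`energy_le_tsum`). The class F hypothesis, applied to μ itself, says that the sum of
μ(Q')² / ℓ(Q') over Q' ⊆ Q is at most 4 ‖w‖_F μ(Q) (`treeSum_le_pairEnergy`). This is a Carleson
packing condition, and the Carleson embedding theorem, proved with a Bellman function
(`treeSum_carleson_bellman`), sums ν(Q)² / ℓ(Q).

Duality. Pairing T f with its own truncation and cancelling a finite factor yields the weighted
bound (`setLIntegral_operator_le`); exhausting the space removes the truncation. -/

theorem mem_dyadicCube_iff {k : ℤ} {m : Fin 3 → ℤ} {x : R3} :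
    x ∈ dyadicCube k m ↔ (fun i => ⌊x i / (2 : ℝ) ^ k⌋) = m := by
  have h2 : (0 : ℝ) < 2 ^ k := by positivity
  simp only [dyadicCube, Set.mem_ofPred_eq, funext_iff, Int.floor_eq_iff, le_div_iff₀ h2,
    div_lt_iff₀ h2, mul_comm]

theorem measurableSet_dyadicCube (k : ℤ) (m : Fin 3 → ℤ) : MeasurableSet (dyadicCube k m) := by
  have : dyadicCube k m =
      ⋂ i, {x : R3 | (2 : ℝ) ^ k * (m i : ℝ) ≤ x i} ∩ {x | x i < (2 : ℝ) ^ k * ((m i : ℝ) + 1)} := by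
    ext x; simp [dyadicCube]
  rw [this]
  refine MeasurableSet.iInter fun i => ?_
  exact (measurableSet_le (by fun_prop) (by fun_prop)).inter
    (measurableSet_lt (by fun_prop) (by fun_prop))

theorem disjoint_dyadicCube (k : ℤ) {m m' : Fin 3 → ℤ} (h : m ≠ m') :
    Disjoint (dyadicCube k m) (dyadicCube k m') := by
  rw [Set.disjoint_left]
  intro x hx hx'
  exact h ((mem_dyadicCube_iff.1 hx).symm.trans (mem_dyadicCube_iff.1 hx'))

theorem iUnion_dyadicCube (k : ℤ) : ⋃ m, dyadicCube k m = Set.univ :=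
  Set.eq_univ_of_forall fun _ => Set.mem_iUnion.2 ⟨_, mem_dyadicCube_iff.2 rfl⟩

/-- The eight dyadic subcubes of half the side length. -/
def dyadicChild (q : ℤ × (Fin 3 → ℤ)) (ε : Fin 3 → Fin 2) : ℤ × (Fin 3 → ℤ) :=
  (q.1 - 1, fun i => q.2 i * 2 + (ε i : ℕ))

/-- The dyadic cube with a paired index. -/
def dyadicCubeP (q : ℤ × (Fin 3 → ℤ)) : Set R3 := dyadicCube q.1 q.2

theorem measurableSet_dyadicCubeP (q : ℤ × (Fin 3 → ℤ)) : MeasurableSet (dyadicCubeP q) :=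
  measurableSet_dyadicCube _ _

theorem dyadicChild_injective (q : ℤ × (Fin 3 → ℤ)) : Function.Injective (dyadicChild q) := by
  intro ε ε' h
  funext i
  have := congrFun (congrArg Prod.snd h) i
  simp only [dyadicChild] at this
  omega

theorem disjoint_dyadicChild (q : ℤ × (Fin 3 → ℤ)) :
    Pairwise (Function.onFun Disjoint fun ε => dyadicCubeP (dyadicChild q ε)) := by
  intro ε ε' h
  refine disjoint_dyadicCube (q.1 - 1) fun h' => h ?_
  exact dyadicChild_injective q (Prod.ext rfl h')

theorem iUnion_dyadicChild (q : ℤ × (Fin 3 → ℤ)) :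
    ⋃ ε, dyadicCubeP (dyadicChild q ε) = dyadicCubeP q := by
  obtain ⟨k, m⟩ := q
  ext x
  have h2 : (0 : ℝ) < 2 ^ k := by positivity
  have key : ∀ i, x i / (2 : ℝ) ^ (k - 1) = 2 * (x i / (2 : ℝ) ^ k) := by
    intro i; rw [zpow_sub_one₀ (by norm_num)]; field_simp
  simp only [Set.mem_iUnion, dyadicCubeP, dyadicChild, mem_dyadicCube_iff, key]
  constructor
  · rintro ⟨ε, h⟩
    funext i
    have hi := congrFun h i
    simp only [Int.floor_eq_iff] at hi ⊢
    push_cast at hi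
    have h1 : ((ε i : ℕ) : ℝ) ≤ 1 := by exact_mod_cast (by omega : (ε i : ℕ) ≤ 1)
    have h0 : (0 : ℝ) ≤ ((ε i : ℕ) : ℝ) := by positivity
    constructor <;> linarith
  · intro h
    -- The choice of child is the next binary digit of each coordinate: ⌊2t⌋ - 2⌊t⌋ is 0 or 1.
    refine ⟨fun i => ⟨(⌊2 * (x i / (2 : ℝ) ^ k)⌋ - 2 * m i).toNat, ?_⟩, ?_⟩
    all_goals
      have hb : ∀ i, 0 ≤ ⌊2 * (x i / (2 : ℝ) ^ k)⌋ - 2 * m i ∧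
          ⌊2 * (x i / (2 : ℝ) ^ k)⌋ - 2 * m i < 2 := by
        intro i
        have hi := congrFun h i
        simp only [Int.floor_eq_iff] at hi
        constructor
        · have : 2 * m i ≤ ⌊2 * (x i / (2 : ℝ) ^ k)⌋ := by
            rw [Int.le_floor]; push_cast; linarith
          omega
        · have : ⌊2 * (x i / (2 : ℝ) ^ k)⌋ < 2 * m i + 2 := by
            rw [Int.floor_lt]; push_cast; linarith
          omega
    · have := hb i; omega
    · funext i
      have := hb i
      simp only
      omega

/-- The diameter is √3 times the side; √3 is rounded up to 2. -/
theorem norm_sub_le_of_mem_dyadicCube {k : ℤ} {m : Fin 3 → ℤ} {x y : R3}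
    (hx : x ∈ dyadicCube k m) (hy : y ∈ dyadicCube k m) : ‖x - y‖ ≤ 2 * (2 : ℝ) ^ k := by
  have h2 : (0 : ℝ) < 2 ^ k := by positivity
  rw [EuclideanSpace.norm_eq, Real.sqrt_le_left (by positivity)]
  have : ∀ i, ‖(x - y) i‖ ^ 2 ≤ ((2 : ℝ) ^ k) ^ 2 := by
    intro i
    rw [Real.norm_eq_abs, sq_le_sq₀ (abs_nonneg _) h2.le, PiLp.sub_apply, abs_le]
    have h1 := hx i
    have h3 := hy i
    constructor <;> nlinarith
  calc ∑ i, ‖(x - y) i‖ ^ 2 ≤ ∑ _i : Fin 3, ((2 : ℝ) ^ k) ^ 2 := Finset.sum_le_sum fun i _ => this i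
    _ = 3 * ((2 : ℝ) ^ k) ^ 2 := by simp
    _ ≤ (2 * (2 : ℝ) ^ k) ^ 2 := by nlinarith [sq_nonneg ((2 : ℝ) ^ k)]

/-! ### Sums over finite trees -/

section Tree

variable {ι β M : Type*} [Fintype β] [AddCommMonoid M]

/-- The sum of `c` over the descendants of `q` of generation at most `n`. -/
def treeSum (child : ι → β → ι) (c : ι → M) : ℕ → ι → M
  | 0, q => c q
  | n + 1, q => c q + ∑ b, treeSum child c n (child q b)

theorem treeSum_coe (child : ι → β → ι) (c : ι → ℝ≥0) (n : ℕ) (q : ι) :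
    ((treeSum child c n q : ℝ≥0) : ℝ≥0∞) = treeSum child (fun q => (c q : ℝ≥0∞)) n q := by
  induction n generalizing q with
  | zero => rfl
  | succ n ih => simp only [treeSum, ENNReal.coe_add, ENNReal.ofNNReal_finsetSum, ih]

/-- The Carleson embedding theorem on a finite tree, in Bellman function form. -/
theorem treeSum_carleson_bellman (child : ι → β → ι) {m G H ρ : ι → ℝ≥0} {B : ℝ≥0}
    (hm : ∀ q, m q = ∑ b, m (child q b)) (hG : ∀ q, G q = ∑ b, G (child q b))
    (hH : ∀ q, H q = ∑ b, H (child q b)) (hGH : ∀ q, G q ^ 2 ≤ m q * H q)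
    (hS : ∀ n q, treeSum child (fun q => ρ q * m q ^ 2) n q ≤ B * m q) (n : ℕ) (q : ι) :
    treeSum child (fun q => ρ q * G q ^ 2) n q +
      4 * B ^ 2 * (G q ^ 2 / (B * m q + treeSum child (fun q => ρ q * m q ^ 2) n q)) ≤
      4 * B * H q := by
  -- One generation of the Bellman argument. Adding ρ m² to the denominator B m + S lowers the
  -- Bellman term by 4 B² G² ρ m² divided by the product of the old and new denominators. By the
  -- packing bound each is at most 2 B m, so the drop pays for ρ G²; this fixes the factor 4.
  have step : ∀ (q : ι) (S : ℝ≥0), S + ρ q * m q ^ 2 ≤ B * m q →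
      ρ q * G q ^ 2 + 4 * B ^ 2 * (G q ^ 2 / (B * m q + (ρ q * m q ^ 2 + S))) ≤
        4 * B ^ 2 * (G q ^ 2 / (B * m q + S)) := by
    intro q S hSq
    rcases eq_or_ne (m q) 0 with h0 | h0
    · have : G q = 0 := by
        have := hGH q
        rw [h0, zero_mul] at this
        exact pow_eq_zero_iff (two_ne_zero) |>.1 (le_antisymm this zero_le)
      simp [this]
    rcases eq_or_ne B 0 with hB | hB
    · subst hB
      have h1 : ρ q * m q ^ 2 = 0 := by
        have : S + ρ q * m q ^ 2 ≤ 0 := by simpa using hSq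
        exact le_antisymm (le_trans le_add_self this) zero_le
      have : ρ q = 0 := by
        rcases mul_eq_zero.1 h1 with h | h
        · exact h
        · exact absurd (pow_eq_zero_iff two_ne_zero |>.1 h) h0
      simp [this]
    have hm0 : (0 : ℝ) < m q := by exact_mod_cast pos_iff_ne_zero.2 h0
    have hB0 : (0 : ℝ) < B := by exact_mod_cast pos_iff_ne_zero.2 hB
    rw [← NNReal.coe_le_coe] at hSq ⊢
    push_cast at hSq ⊢
    have hS0 : (0 : ℝ) ≤ S := S.2
    have hρ0 : (0 : ℝ) ≤ ρ q := (ρ q).2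
    generalize (m q : ℝ) = m' at *
    generalize (G q : ℝ) = G' at *
    generalize (B : ℝ) = B' at *
    generalize (S : ℝ) = S' at *
    generalize (ρ q : ℝ) = r' at *
    have hc : 0 ≤ r' * m' ^ 2 := by positivity
    have hx : 0 < B' * m' + S' := by positivity
    have hy : 0 < B' * m' + (r' * m' ^ 2 + S') := by positivity
    have hxy : (B' * m' + S') * (B' * m' + (r' * m' ^ 2 + S')) ≤ 4 * B' ^ 2 * m' ^ 2 := by
      have h1 : B' * m' + S' ≤ 2 * (B' * m') := by linarith
      have h2 : B' * m' + (r' * m' ^ 2 + S') ≤ 2 * (B' * m') := by linarith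
      calc _ ≤ (2 * (B' * m')) * (2 * (B' * m')) := mul_le_mul h1 h2 hy.le (by positivity)
        _ = _ := by ring
    have e : 4 * B' ^ 2 * (G' ^ 2 / (B' * m' + S')) -
        4 * B' ^ 2 * (G' ^ 2 / (B' * m' + (r' * m' ^ 2 + S'))) =
        (r' * G' ^ 2) * (4 * B' ^ 2 * m' ^ 2) /
          ((B' * m' + S') * (B' * m' + (r' * m' ^ 2 + S'))) := by
      field_simp
      ring
    have : r' * G' ^ 2 ≤ (r' * G' ^ 2) * (4 * B' ^ 2 * m' ^ 2) /
          ((B' * m' + S') * (B' * m' + (r' * m' ^ 2 + S'))) := by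
      rw [le_div_iff₀ (by positivity)]
      exact mul_le_mul_of_nonneg_left hxy (by positivity)
    linarith
  induction n generalizing q with
  | zero =>
    have h := step q 0 (by simpa [treeSum] using hS 0 q)
    simp only [add_zero] at h
    refine h.trans ?_
    rcases eq_or_ne (m q) 0 with h0 | h0
    · simp [h0]
    rcases eq_or_ne B 0 with hB | hB
    · simp [hB]
    have : G q ^ 2 / (B * m q) ≤ H q / B := by
      rw [div_le_div_iff₀ (by positivity) (by positivity)]
      calc G q ^ 2 * B ≤ m q * H q * B := by gcongr; exact hGH q
        _ = _ := by ring
    calc 4 * B ^ 2 * (G q ^ 2 / (B * m q)) ≤ 4 * B ^ 2 * (H q / B) := by gcongr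
      _ = 4 * B * H q := by field_simp
  | succ n ih =>
    set S := ∑ b, treeSum child (fun q => ρ q * m q ^ 2) n (child q b) with hSdef
    have h := step q S (by rw [add_comm]; exact hS (n + 1) q)
    have h2 : 4 * B ^ 2 * (G q ^ 2 / (B * m q + S)) ≤ 4 * B ^ 2 * ∑ b, G (child q b) ^ 2 /
        (B * m (child q b) + treeSum child (fun q => ρ q * m q ^ 2) n (child q b)) := by
      rcases eq_or_ne B 0 with hB | hB
      · simp [hB]
      gcongr
      have e : B * m q + S = ∑ b, (B * m (child q b) +
          treeSum child (fun q => ρ q * m q ^ 2) n (child q b)) := by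
        rw [Finset.sum_add_distrib, ← Finset.mul_sum, ← hm]
      rw [e, hG q]
      -- Joint convexity of G² / x, as Cauchy–Schwarz: (∑ G)² / ∑ x ≤ ∑ G² / x. A child with m = 0
      -- also has G = 0, so division by zero is harmless.
      refine div_le_of_le_mul₀ zero_le zero_le
        (Finset.sum_sq_le_sum_mul_sum_of_sq_le_mul _ (fun _ _ => zero_le)
          (fun _ _ => zero_le) fun b _ => ?_)
      rcases eq_or_ne (m (child q b)) 0 with h0 | h0
      · have := hGH (child q b)
        rw [h0, zero_mul] at this
        exact this.trans zero_le
      · rw [div_mul_cancel₀]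
        positivity
    simp only [treeSum]
    calc _ = (ρ q * G q ^ 2 + 4 * B ^ 2 * (G q ^ 2 / (B * m q + (ρ q * m q ^ 2 + S)))) +
          ∑ b, treeSum child (fun q => ρ q * G q ^ 2) n (child q b) := by
          rw [hSdef]; ring
      _ ≤ 4 * B ^ 2 * (∑ b, G (child q b) ^ 2 /
        (B * m (child q b) + treeSum child (fun q => ρ q * m q ^ 2) n (child q b))) +
          ∑ b, treeSum child (fun q => ρ q * G q ^ 2) n (child q b) := by
          gcongr
          exact h.trans h2
      _ = ∑ b, (treeSum child (fun q => ρ q * G q ^ 2) n (child q b) + 4 * B ^ 2 *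
          (G (child q b) ^ 2 / (B * m (child q b) +
            treeSum child (fun q => ρ q * m q ^ 2) n (child q b)))) := by
          rw [Finset.sum_add_distrib, Finset.mul_sum, add_comm]
      _ ≤ ∑ b, 4 * B * H (child q b) := Finset.sum_le_sum fun b _ => ih _
      _ = 4 * B * H q := by rw [← Finset.mul_sum, ← hH]

end Tree

/-! ### The trace inequality -/

/-- The mutual energy of two sets with respect to a measure. -/
noncomputable def pairEnergy (μ : Measure R3) (S T : Set R3) : ℝ≥0∞ :=
  ∫⁻ x in S, ∫⁻ y in T, ‖x - y‖ₑ⁻¹ ∂μ ∂μ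

theorem measurable_enorm_sub_inv : Measurable fun p : R3 × R3 => ‖p.1 - p.2‖ₑ⁻¹ := by fun_prop

theorem measurable_potential (μ : Measure R3) [SFinite μ] :
    Measurable fun x => ∫⁻ y, ‖x - y‖ₑ⁻¹ ∂μ :=
  Measurable.lintegral_prod_right' measurable_enorm_sub_inv

theorem pairEnergy_dyadicCubeP (μ : Measure R3) [SFinite μ] (q : ℤ × (Fin 3 → ℤ)) :
    pairEnergy μ (dyadicCubeP q) (dyadicCubeP q) =
      ∑ ε, ∑ ε', pairEnergy μ (dyadicCubeP (dyadicChild q ε)) (dyadicCubeP (dyadicChild q ε')) := by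
  unfold pairEnergy
  have h : ∀ f : R3 → ℝ≥0∞, ∫⁻ x in dyadicCubeP q, f x ∂μ =
      ∑ ε, ∫⁻ x in dyadicCubeP (dyadicChild q ε), f x ∂μ := by
    intro f
    rw [← iUnion_dyadicChild q, lintegral_iUnion (fun ε => measurableSet_dyadicCubeP _)
      (disjoint_dyadicChild q), tsum_fintype]
  rw [h]
  refine Finset.sum_congr rfl fun ε _ => ?_
  simp_rw [h]
  rw [lintegral_finsetSum]
  intro ε' _
  exact measurable_potential _

/-- The reciprocal of the side length of a dyadic cube of generation `k`. -/
noncomputable def sideInv (k : ℤ) : ℝ≥0 := (2 : ℝ≥0) ^ (-k)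

theorem sideInv_sub_one (k : ℤ) : sideInv (k - 1) = 2 * sideInv k := by
  unfold sideInv
  rw [neg_sub, sub_eq_add_neg, zpow_add₀ two_ne_zero, zpow_one]

/-- Inside a cube of side 2^k the kernel is at least half of 2^(-k); integrate over S × T. -/
theorem sideInv_mul_measure_le (μ : Measure R3) [SFinite μ] {k : ℤ} {m : Fin 3 → ℤ} {S T : Set R3}
    (hS : S ⊆ dyadicCube k m) (hT : T ⊆ dyadicCube k m) (hSm : MeasurableSet S)
    (hTm : MeasurableSet T) :
    (sideInv k : ℝ≥0∞) * (μ S * μ T) ≤ 2 * pairEnergy μ S T := by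
  have h : ∀ x ∈ S, ∀ y ∈ T, (sideInv k : ℝ≥0∞) ≤ 2 * ‖x - y‖ₑ⁻¹ := by
    intro x hx y hy
    have h1 := norm_sub_le_of_mem_dyadicCube (hS hx) (hT hy)
    have h2 : ‖x - y‖ₑ ≤ 2 * (sideInv k : ℝ≥0∞)⁻¹ := by
      have h3 : ‖x - y‖₊ ≤ 2 * (2 : ℝ≥0) ^ k := by
        rw [← NNReal.coe_le_coe]; push_cast; exact h1
      have h4 : (sideInv k : ℝ≥0)⁻¹ = (2 : ℝ≥0) ^ k := by simp [sideInv]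
      have h5 : sideInv k ≠ 0 := by unfold sideInv; positivity
      rw [← ENNReal.coe_inv h5, h4]
      exact_mod_cast h3
    have h5 : (sideInv k : ℝ≥0∞) ≠ 0 := by
      have : sideInv k ≠ 0 := by unfold sideInv; positivity
      exact_mod_cast this
    calc (sideInv k : ℝ≥0∞) = 2 * (2 * (sideInv k : ℝ≥0∞)⁻¹)⁻¹ := by
          rw [ENNReal.mul_inv (by simp) (by simp), inv_inv, ← mul_assoc,
            ENNReal.mul_inv_cancel (by simp) (by simp), one_mul]
      _ ≤ 2 * ‖x - y‖ₑ⁻¹ := by gcongr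
  unfold pairEnergy
  calc (sideInv k : ℝ≥0∞) * (μ S * μ T) = ∫⁻ _ in S, ∫⁻ _ in T, (sideInv k : ℝ≥0∞) ∂μ ∂μ := by
        simp [mul_comm, mul_left_comm]
    _ ≤ ∫⁻ x in S, ∫⁻ y in T, 2 * ‖x - y‖ₑ⁻¹ ∂μ ∂μ :=
        setLIntegral_mono' hSm fun x hx => setLIntegral_mono' hTm fun y hy => h x hx y hy
    _ = 2 * ∫⁻ x in S, ∫⁻ y in T, ‖x - y‖ₑ⁻¹ ∂μ ∂μ := by
        rw [← lintegral_const_mul _ (measurable_potential _)]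
        congr 1; funext x
        rw [lintegral_const_mul _ (by fun_prop)]

theorem measure_dyadicCubeP_eq_sum (μ : Measure R3) (q : ℤ × (Fin 3 → ℤ)) :
    μ (dyadicCubeP q) = ∑ ε, μ (dyadicCubeP (dyadicChild q ε)) := by
  rw [← iUnion_dyadicChild q, measure_iUnion (disjoint_dyadicChild q)
    (fun ε => measurableSet_dyadicCubeP _), tsum_fintype]

theorem dyadicChild_subset (q : ℤ × (Fin 3 → ℤ)) (ε : Fin 3 → Fin 2) :
    dyadicCubeP (dyadicChild q ε) ⊆ dyadicCubeP q := by
  rw [← iUnion_dyadicChild q]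
  exact Set.subset_iUnion (fun ε => dyadicCubeP (dyadicChild q ε)) ε

/-- The packing sums of `μ(Q)² / ℓ(Q)` are controlled by the energy. -/
theorem treeSum_le_pairEnergy (μ : Measure R3) [SFinite μ] (n : ℕ) (q : ℤ × (Fin 3 → ℤ)) :
    treeSum dyadicChild (fun q => (sideInv q.1 : ℝ≥0∞) * μ (dyadicCubeP q) ^ 2) n q +
      (sideInv q.1 : ℝ≥0∞) * μ (dyadicCubeP q) ^ 2 ≤
      4 * pairEnergy μ (dyadicCubeP q) (dyadicCubeP q) := by
  -- The extra copy of the root term closes the induction. Two copies of μ(Q)² / ℓ(Q) expand over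
  -- pairs of children. Since the side halves, a diagonal pair is exactly the extra copy needed by
  -- that child; an off-diagonal pair is paid for by the mutual energy of two distinct children,
  -- which the induction hypothesis leaves unspent.
  induction n generalizing q with
  | zero =>
    have h := sideInv_mul_measure_le μ (S := dyadicCubeP q) (T := dyadicCubeP q)
      subset_rfl subset_rfl (measurableSet_dyadicCubeP q) (measurableSet_dyadicCubeP q)
    simp only [treeSum]
    calc _ = 2 * ((sideInv q.1 : ℝ≥0∞) * (μ (dyadicCubeP q) * μ (dyadicCubeP q))) := by ring
      _ ≤ 2 * (2 * pairEnergy μ (dyadicCubeP q) (dyadicCubeP q)) := by gcongr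
      _ = _ := by ring
  | succ n ih =>
    simp only [treeSum]
    set S := treeSum dyadicChild (fun q => (sideInv q.1 : ℝ≥0∞) * μ (dyadicCubeP q) ^ 2) n
    set Q := fun ε => dyadicCubeP (dyadicChild q ε) with hQ
    have e : 2 * ((sideInv q.1 : ℝ≥0∞) * μ (dyadicCubeP q) ^ 2) =
        ∑ ε, ∑ ε', 2 * ((sideInv q.1 : ℝ≥0∞) * (μ (Q ε) * μ (Q ε'))) := by
      rw [measure_dyadicCubeP_eq_sum μ q, sq, Finset.sum_mul_sum]
      simp only [Finset.mul_sum, hQ]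
    calc _ = 2 * ((sideInv q.1 : ℝ≥0∞) * μ (dyadicCubeP q) ^ 2) +
          ∑ ε, S (dyadicChild q ε) := by ring
      _ = ∑ ε, (S (dyadicChild q ε) +
          ∑ ε', 2 * ((sideInv q.1 : ℝ≥0∞) * (μ (Q ε) * μ (Q ε')))) := by
          rw [e, Finset.sum_add_distrib, add_comm]
      _ ≤ ∑ ε, ∑ ε', 4 * pairEnergy μ (Q ε) (Q ε') := by
          refine Finset.sum_le_sum fun ε _ => ?_
          rw [← Finset.add_sum_erase _ _ (Finset.mem_univ ε),
            ← Finset.add_sum_erase _ _ (Finset.mem_univ ε), ← add_assoc]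
          refine add_le_add ?_ (Finset.sum_le_sum fun ε' _ => ?_)
          · have h := ih (dyadicChild q ε)
            have h1 : (sideInv (dyadicChild q ε).1 : ℝ≥0∞) = 2 * (sideInv q.1 : ℝ≥0∞) := by
              rw [dyadicChild, sideInv_sub_one]; push_cast; rfl
            rw [h1] at h
            calc _ = S (dyadicChild q ε) + 2 * (sideInv q.1 : ℝ≥0∞) * μ (Q ε) ^ 2 := by ring
              _ ≤ _ := h
          · have h := sideInv_mul_measure_le μ (dyadicChild_subset q ε) (dyadicChild_subset q ε')
              (measurableSet_dyadicCubeP _) (measurableSet_dyadicCubeP _)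
            calc _ ≤ 2 * (2 * pairEnergy μ (Q ε) (Q ε')) := mul_le_mul_right h 2
              _ = _ := by ring
      _ = _ := by
          rw [pairEnergy_dyadicCubeP, Finset.mul_sum]
          simp only [Finset.mul_sum, hQ]

/-- The dyadic Carleson embedding, for subcubes of a fixed cube. -/
theorem treeSum_lintegral_le (μ : Measure R3) [SFinite μ] {A : ℝ≥0}
    (hfin : ∀ q, μ (dyadicCubeP q) ≠ ⊤)
    (hA : ∀ q, pairEnergy μ (dyadicCubeP q) (dyadicCubeP q) ≤ A * μ (dyadicCubeP q))
    {g : R3 → ℝ≥0∞} (hg : Measurable g) (hg2 : ∫⁻ x, g x ^ 2 ∂μ ≠ ⊤) (n : ℕ)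
    (q : ℤ × (Fin 3 → ℤ)) :
    treeSum dyadicChild
        (fun q => (sideInv q.1 : ℝ≥0∞) * (∫⁻ x in dyadicCubeP q, g x ∂μ) ^ 2) n q ≤
      16 * A * ∫⁻ x in dyadicCubeP q, g x ^ 2 ∂μ := by
  have hHfin : ∀ q, ∫⁻ x in dyadicCubeP q, g x ^ 2 ∂μ ≠ ⊤ := fun q =>
    ne_top_of_le_ne_top hg2 (setLIntegral_le_lintegral _ _)
  have hGH : ∀ q, (∫⁻ x in dyadicCubeP q, g x ∂μ) ^ 2 ≤
      μ (dyadicCubeP q) * ∫⁻ x in dyadicCubeP q, g x ^ 2 ∂μ := by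
    intro q
    have h := ENNReal.lintegral_mul_le_Lp_mul_Lq (μ.restrict (dyadicCubeP q))
      Real.HolderConjugate.two_two (f := fun _ => 1) (g := g) (by fun_prop) hg.aemeasurable
    simp only [Pi.mul_apply, one_mul, ENNReal.rpow_two, one_pow, lintegral_const, Measure.restrict_apply,
      MeasurableSet.univ, Set.univ_inter] at h
    calc _ ≤ (μ (dyadicCubeP q) ^ (1 / 2 : ℝ) *
          (∫⁻ x in dyadicCubeP q, g x ^ 2 ∂μ) ^ (1 / 2 : ℝ)) ^ 2 := by gcongr
      _ = _ := by
        rw [mul_pow, ← ENNReal.rpow_natCast, ← ENNReal.rpow_natCast, ← ENNReal.rpow_mul,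
          ← ENNReal.rpow_mul]
        norm_num
  have hGfin : ∀ q, ∫⁻ x in dyadicCubeP q, g x ∂μ ≠ ⊤ := by
    intro q h
    have := hGH q
    rw [h] at this
    exact ENNReal.mul_ne_top (hfin q) (hHfin q) (top_le_iff.1 (by simpa using this))
  have hsum : ∀ (f : R3 → ℝ≥0∞) q, ∫⁻ x in dyadicCubeP q, f x ∂μ =
      ∑ ε, ∫⁻ x in dyadicCubeP (dyadicChild q ε), f x ∂μ := by
    intro f q
    rw [← iUnion_dyadicChild q, lintegral_iUnion (fun ε => measurableSet_dyadicCubeP _)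
      (disjoint_dyadicChild q), tsum_fintype]
  have hS := fun n q => (le_self_add.trans (treeSum_le_pairEnergy μ n q)).trans
    (mul_le_mul_right (hA q) 4)
  have hmsum := measure_dyadicCubeP_eq_sum μ
  have hGsum := hsum g
  have hHsum := hsum (fun x => g x ^ 2)
  obtain ⟨m, hm⟩ : ∃ m : ℤ × (Fin 3 → ℤ) → ℝ≥0, ∀ q, μ (dyadicCubeP q) = m q :=
    ⟨fun q => (μ (dyadicCubeP q)).toNNReal, fun q => (ENNReal.coe_toNNReal (hfin q)).symm⟩
  obtain ⟨G, hG⟩ : ∃ G : ℤ × (Fin 3 → ℤ) → ℝ≥0, ∀ q, ∫⁻ x in dyadicCubeP q, g x ∂μ = G q :=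
    ⟨fun q => (∫⁻ x in dyadicCubeP q, g x ∂μ).toNNReal,
      fun q => (ENNReal.coe_toNNReal (hGfin q)).symm⟩
  obtain ⟨H, hH⟩ : ∃ H : ℤ × (Fin 3 → ℤ) → ℝ≥0, ∀ q, ∫⁻ x in dyadicCubeP q, g x ^ 2 ∂μ = H q :=
    ⟨fun q => (∫⁻ x in dyadicCubeP q, g x ^ 2 ∂μ).toNNReal,
      fun q => (ENNReal.coe_toNNReal (hHfin q)).symm⟩
  have hc : ∀ u : ℤ × (Fin 3 → ℤ) → ℝ≥0, (fun q : ℤ × (Fin 3 → ℤ) =>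
      (sideInv q.1 : ℝ≥0∞) * (u q : ℝ≥0∞) ^ 2) =
      fun q => ((sideInv q.1 * u q ^ 2 : ℝ≥0) : ℝ≥0∞) := by
    intro u; funext q; push_cast; rfl
  simp only [hm, hG, hH] at hS hmsum hGsum hHsum hGH ⊢
  simp only [hc, ← treeSum_coe] at hS ⊢
  -- The packing constant is B = 4A, so the embedding constant 4B is 16A.
  have key := treeSum_carleson_bellman dyadicChild (m := m) (G := G) (H := H)
    (ρ := fun q => sideInv q.1) (B := 4 * A) (fun q => by exact_mod_cast hmsum q)
    (fun q => by exact_mod_cast hGsum q) (fun q => by exact_mod_cast hHsum q)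
    (fun q => by exact_mod_cast hGH q)
    (fun n q => by
      have := hS n q
      rw [← mul_assoc] at this
      exact_mod_cast this) n q
  have key2 := le_self_add.trans key
  rw [← mul_assoc] at key2
  norm_num at key2
  exact_mod_cast key2

/-- Indices of cubes and of their children correspond. -/
def childEquiv : (Fin 3 → ℤ) ≃ (Fin 3 → ℤ) × (Fin 3 → Fin 2) :=
  (Equiv.arrowCongr (Equiv.refl _) (Int.divModEquiv 2)).trans
    (Equiv.arrowProdEquivProdArrow (Fin 3) (fun _ => ℤ) (fun _ => Fin 2))

theorem childEquiv_symm_apply (p : (Fin 3 → ℤ) × (Fin 3 → Fin 2)) (k : ℤ) :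
    (k - 1, childEquiv.symm p) = dyadicChild (k, p.1) p.2 := by
  rfl

/-- Each cube of generation k - 1 is a child of exactly one cube of generation k, so the trees below
all roots list every generation once. -/
theorem tsum_treeSum (c : ℤ × (Fin 3 → ℤ) → ℝ≥0∞) (n : ℕ) (k : ℤ) :
    ∑' m, treeSum dyadicChild c n (k, m) =
      ∑ j ∈ Finset.range (n + 1), ∑' m, c (k - j, m) := by
  induction n generalizing k with
  | zero => simp [treeSum]
  | succ n ih =>
    simp only [treeSum]
    rw [ENNReal.tsum_add, Finset.sum_range_succ', add_comm]
    congr 1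
    · calc _ = ∑' m, ∑' ε, treeSum dyadicChild c n (dyadicChild (k, m) ε) := by
            simp only [tsum_fintype]
        _ = ∑' p : (Fin 3 → ℤ) × (Fin 3 → Fin 2),
              treeSum dyadicChild c n (dyadicChild (k, p.1) p.2) :=
            (ENNReal.tsum_prod (f := fun m ε =>
              treeSum dyadicChild c n (dyadicChild (k, m) ε))).symm
        _ = ∑' m, treeSum dyadicChild c n (k - 1, m) := by
            simp only [← childEquiv_symm_apply]
            exact childEquiv.symm.tsum_eq fun m => treeSum dyadicChild c n (k - 1, m)
        _ = _ := by
            rw [ih]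
            refine Finset.sum_congr rfl fun j _ => ?_
            congr 1; funext m; congr 2; push_cast; ring
    · simp

/-- The dyadic Carleson embedding over all cubes. -/
theorem tsum_sideInv_lintegral_le (μ : Measure R3) [SFinite μ] {A : ℝ≥0}
    (hfin : ∀ q, μ (dyadicCubeP q) ≠ ⊤)
    (hA : ∀ q, pairEnergy μ (dyadicCubeP q) (dyadicCubeP q) ≤ A * μ (dyadicCubeP q))
    {g : R3 → ℝ≥0∞} (hg : Measurable g) (hg2 : ∫⁻ x, g x ^ 2 ∂μ ≠ ⊤) :
    ∑' k : ℤ, ∑' m, (sideInv k : ℝ≥0∞) * (∫⁻ x in dyadicCube k m, g x ∂μ) ^ 2 ≤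
      16 * A * ∫⁻ x, g x ^ 2 ∂μ := by
  set c : ℤ × (Fin 3 → ℤ) → ℝ≥0∞ := fun q =>
    (sideInv q.1 : ℝ≥0∞) * (∫⁻ x in dyadicCubeP q, g x ∂μ) ^ 2 with hc
  change ∑' k : ℤ, ∑' m, c (k, m) ≤ _
  rw [ENNReal.tsum_eq_iSup_sum]
  refine iSup_le fun s => ?_
  -- Finitely many scales lie in [-N, N], hence in the trees of depth 2N with roots of generation N.
  obtain ⟨N, hN⟩ : ∃ N : ℕ, ∀ k ∈ s, k.natAbs ≤ N :=
    ⟨s.sup Int.natAbs, fun k hk => Finset.le_sup (f := Int.natAbs) hk⟩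
  calc ∑ k ∈ s, ∑' m, c (k, m)
      ≤ ∑ k ∈ (Finset.range (2 * N + 1)).image (fun j : ℕ => (N : ℤ) - j), ∑' m, c (k, m) := by
        refine Finset.sum_le_sum_of_subset fun k hk => ?_
        have := hN k hk
        rw [Finset.mem_image]
        exact ⟨((N : ℤ) - k).toNat, by rw [Finset.mem_range]; omega, by omega⟩
    _ = ∑ j ∈ Finset.range (2 * N + 1), ∑' m, c ((N : ℤ) - j, m) := by
        rw [Finset.sum_image]
        intro i _ j _ h
        simp only at h
        omega
    _ = ∑' m, treeSum dyadicChild c (2 * N) ((N : ℤ), m) := (tsum_treeSum c _ _).symm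
    _ ≤ ∑' m, 16 * A * ∫⁻ x in dyadicCube N m, g x ^ 2 ∂μ :=
        ENNReal.tsum_le_tsum fun m => treeSum_lintegral_le μ hfin hA hg hg2 _ _
    _ = 16 * A * ∫⁻ x, g x ^ 2 ∂μ := by
        rw [ENNReal.tsum_mul_left, ← lintegral_iUnion (fun m => measurableSet_dyadicCube _ m)
          (fun m m' h => disjoint_dyadicCube _ h), iUnion_dyadicCube, Measure.restrict_univ]

/-- Offsets between neighbouring cubes of the same generation. -/
noncomputable def neighbours : Finset (Fin 3 → ℤ) := Finset.Icc (-1) 1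

/-- If 2^n < |x-y| ≤ 2^(n+1), take k = n + 1. Coordinates differ by at most 2^k, so the cubes of
generation k containing x and y are equal or adjacent, and 1/|x-y| ≤ 2 · 2^(-k). Allowing adjacent
cubes avoids translated grids. -/
theorem enorm_sub_inv_le_tsum {x y : R3} (h : x ≠ y) :
    ‖x - y‖ₑ⁻¹ ≤ ∑' k : ℤ, ∑' m : Fin 3 → ℤ, ∑ δ ∈ neighbours, 2 * (sideInv k : ℝ≥0∞) *
      ((dyadicCube k m).indicator 1 x * (dyadicCube k (m + δ)).indicator 1 y) := by
  have hd : 0 < ‖x - y‖ := norm_pos_iff.2 (sub_ne_zero.2 h)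
  obtain ⟨n, hn1, hn2⟩ := exists_mem_Ioc_zpow hd (one_lt_two : (1 : ℝ) < 2)
  set k := n + 1 with hk
  have h2 : (0 : ℝ) < 2 ^ k := by positivity
  set m : Fin 3 → ℤ := fun i => ⌊x i / (2 : ℝ) ^ k⌋ with hm
  set m' : Fin 3 → ℤ := fun i => ⌊y i / (2 : ℝ) ^ k⌋ with hm'
  have hδ : m' - m ∈ neighbours := by
    have key : ∀ i, |x i / (2 : ℝ) ^ k - y i / (2 : ℝ) ^ k| ≤ 1 := by
      intro i
      rw [← sub_div, abs_div, abs_of_pos h2, div_le_one h2]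
      exact (PiLp.norm_apply_le (x - y) i).trans hn2
    have : ∀ i, -1 ≤ m' i - m i ∧ m' i - m i ≤ 1 := by
      intro i
      have h1 := abs_le.1 (key i)
      have a1 := Int.floor_le (x i / (2 : ℝ) ^ k)
      have a2 := Int.lt_floor_add_one (x i / (2 : ℝ) ^ k)
      have a3 := Int.floor_le (y i / (2 : ℝ) ^ k)
      have a4 := Int.lt_floor_add_one (y i / (2 : ℝ) ^ k)
      have b1 : m i < m' i + 2 := by
        have : (m i : ℝ) < m' i + 2 := by simp only [hm, hm']; linarith
        exact_mod_cast this
      have b2 : m' i < m i + 2 := by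
        have : (m' i : ℝ) < m i + 2 := by simp only [hm, hm']; linarith
        exact_mod_cast this
      omega
    rw [neighbours, Finset.mem_Icc]
    exact ⟨fun i => (this i).1, fun i => (this i).2⟩
  have hx : x ∈ dyadicCube k m := mem_dyadicCube_iff.2 rfl
  have hy : y ∈ dyadicCube k (m + (m' - m)) := by
    rw [add_sub_cancel]; exact mem_dyadicCube_iff.2 rfl
  have hle : ‖x - y‖ₑ⁻¹ ≤ 2 * (sideInv k : ℝ≥0∞) := by
    rw [ENNReal.inv_le_iff_inv_le]
    have e : (2 * (sideInv k : ℝ≥0∞))⁻¹ = (((2 : ℝ≥0) ^ n : ℝ≥0) : ℝ≥0∞) := by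
      have h5 : 2 * sideInv k ≠ 0 := by unfold sideInv; positivity
      have h6 : (2 * sideInv k)⁻¹ = (2 : ℝ≥0) ^ n := by
        rw [← sideInv_sub_one, hk, add_sub_cancel_right]; simp [sideInv]
      rw [← h6, ENNReal.coe_inv h5]; push_cast; rfl
    rw [e]
    have : (2 : ℝ≥0) ^ n ≤ ‖x - y‖₊ := by
      rw [← NNReal.coe_le_coe]; push_cast; exact hn1.le
    exact_mod_cast this
  calc ‖x - y‖ₑ⁻¹ ≤ 2 * (sideInv k : ℝ≥0∞) * ((dyadicCube k m).indicator 1 x *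
          (dyadicCube k (m + (m' - m))).indicator 1 y) := by
          rw [Set.indicator_of_mem hx, Set.indicator_of_mem hy]
          simpa using hle
    _ ≤ ∑ δ ∈ neighbours, 2 * (sideInv k : ℝ≥0∞) *
      ((dyadicCube k m).indicator 1 x * (dyadicCube k (m + δ)).indicator 1 y) :=
        Finset.single_le_sum (f := fun δ => 2 * (sideInv k : ℝ≥0∞) *
          ((dyadicCube k m).indicator 1 x * (dyadicCube k (m + δ)).indicator 1 y))
          (fun _ _ => zero_le) hδ
    _ ≤ _ := (ENNReal.le_tsum m).trans (ENNReal.le_tsum (f := fun k : ℤ =>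
        ∑' m : Fin 3 → ℤ, ∑ δ ∈ neighbours, 2 * (sideInv k : ℝ≥0∞) *
      ((dyadicCube k m).indicator 1 x * (dyadicCube k (m + δ)).indicator 1 y)) k)

/-- The Coulomb energy is controlled by the dyadic energy of the standard grid. -/
theorem energy_le_tsum (ν : Measure R3) [SFinite ν] [NullSingletonClass ν] :
    ∫⁻ x, ∫⁻ y, ‖x - y‖ₑ⁻¹ ∂ν ∂ν ≤
      4 * neighbours.card * ∑' k : ℤ, ∑' m, (sideInv k : ℝ≥0∞) * ν (dyadicCube k m) ^ 2 := by
  have hmeas : ∀ k m δ, Measurable fun p : R3 × R3 => 2 * (sideInv k : ℝ≥0∞) *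
      ((dyadicCube k m).indicator 1 p.1 * (dyadicCube k (m + δ)).indicator 1 p.2) := by
    intro k m δ
    refine Measurable.const_mul (Measurable.mul ?_ ?_) _
    · exact (measurable_one.indicator (measurableSet_dyadicCube _ _)).comp measurable_fst
    · exact (measurable_one.indicator (measurableSet_dyadicCube _ _)).comp measurable_snd
  have hint : ∀ k m δ, ∫⁻ x, ∫⁻ y, 2 * (sideInv k : ℝ≥0∞) *
      ((dyadicCube k m).indicator 1 x * (dyadicCube k (m + δ)).indicator 1 y) ∂ν ∂ν =
      2 * (sideInv k : ℝ≥0∞) * (ν (dyadicCube k m) * ν (dyadicCube k (m + δ))) := by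
    intro k m δ
    have h1 : ∀ m, Measurable ((dyadicCube k m).indicator (1 : R3 → ℝ≥0∞)) := fun m =>
      measurable_one.indicator (measurableSet_dyadicCube _ _)
    have h2 := h1 m
    have h3 := h1 (m + δ)
    simp_rw [← mul_assoc]
    have : ∀ x, ∫⁻ y, 2 * (sideInv k : ℝ≥0∞) * (dyadicCube k m).indicator 1 x *
        (dyadicCube k (m + δ)).indicator 1 y ∂ν =
        2 * (sideInv k : ℝ≥0∞) * (dyadicCube k m).indicator 1 x * ν (dyadicCube k (m + δ)) := by
      intro x
      rw [lintegral_const_mul _ h3, lintegral_indicator_one (measurableSet_dyadicCube _ _)]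
    simp_rw [this]
    rw [lintegral_mul_const _ (by fun_prop), lintegral_const_mul _ h2,
      lintegral_indicator_one (measurableSet_dyadicCube _ _)]
  calc _ ≤ ∫⁻ x, ∫⁻ y, ∑' k : ℤ, ∑' m : Fin 3 → ℤ, ∑ δ ∈ neighbours, 2 * (sideInv k : ℝ≥0∞) *
      ((dyadicCube k m).indicator 1 x * (dyadicCube k (m + δ)).indicator 1 y) ∂ν ∂ν := by
        refine lintegral_mono fun x => lintegral_mono_ae ?_
        have : ∀ᵐ y ∂ν, y ≠ x := by simp [ae_iff]
        filter_upwards [this] with y hy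
        exact enorm_sub_inv_le_tsum hy.symm
    _ = ∑' k : ℤ, ∑' m : Fin 3 → ℤ, ∑ δ ∈ neighbours, 2 * (sideInv k : ℝ≥0∞) *
          (ν (dyadicCube k m) * ν (dyadicCube k (m + δ))) := by
        rw [lintegral_lintegral]
        swap
        · exact (Measurable.tsum fun k => Measurable.tsum fun m =>
            Finset.measurable_fun_sum _ fun δ _ => hmeas k m δ).aemeasurable
        rw [lintegral_tsum fun k => (Measurable.tsum fun m =>
            Finset.measurable_fun_sum _ fun δ _ => hmeas k m δ).aemeasurable]
        congr 1; funext k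
        rw [lintegral_tsum fun m => (
            Finset.measurable_fun_sum _ fun δ _ => hmeas k m δ).aemeasurable]
        congr 1; funext m
        rw [lintegral_finsetSum _ fun δ _ => hmeas k m δ]
        refine Finset.sum_congr rfl fun δ _ => ?_
        rw [← hint, lintegral_lintegral (hmeas k m δ).aemeasurable]
    _ ≤ ∑' k : ℤ, 4 * neighbours.card *
          ∑' m, (sideInv k : ℝ≥0∞) * ν (dyadicCube k m) ^ 2 := by
        refine ENNReal.tsum_le_tsum fun k => ?_
        calc _ ≤ ∑' m : Fin 3 → ℤ, ∑ δ ∈ neighbours, 2 * (sideInv k : ℝ≥0∞) *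
              (ν (dyadicCube k m) ^ 2 + ν (dyadicCube k (m + δ)) ^ 2) := by
              refine ENNReal.tsum_le_tsum fun m => Finset.sum_le_sum fun δ _ => ?_
              gcongr
              generalize ν (dyadicCube k m) = a
              generalize ν (dyadicCube k (m + δ)) = b
              rcases le_total a b with h | h
              · calc a * b ≤ b * b := by gcongr
                  _ ≤ _ := by rw [← sq]; exact le_add_self
              · calc a * b ≤ a * a := by gcongr
                  _ ≤ _ := by rw [← sq]; exact le_self_add
          _ = ∑ δ ∈ neighbours, ∑' m : Fin 3 → ℤ, 2 * (sideInv k : ℝ≥0∞) *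
              (ν (dyadicCube k m) ^ 2 + ν (dyadicCube k (m + δ)) ^ 2) :=
              Summable.tsum_finsetSum fun _ _ => ENNReal.summable
          _ = ∑ δ ∈ neighbours, 4 * (sideInv k : ℝ≥0∞) * ∑' m, ν (dyadicCube k m) ^ 2 := by
              refine Finset.sum_congr rfl fun δ _ => ?_
              -- Translation by δ permutes the cubes of one generation, so after ab ≤ a² + b² every
              -- neighbour offset contributes the same diagonal sum.
              have hshift : ∑' m, ν (dyadicCube k (m + δ)) ^ 2 = ∑' m, ν (dyadicCube k m) ^ 2 :=
                (Equiv.addRight δ).tsum_eq fun m => ν (dyadicCube k m) ^ 2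
              rw [ENNReal.tsum_mul_left, ENNReal.tsum_add, hshift]
              ring
          _ = _ := by
              rw [Finset.sum_const, nsmul_eq_mul, ENNReal.tsum_mul_left]; ring
    _ = _ := by rw [ENNReal.tsum_mul_left]

/-- The trace inequality for the kernel `1 / |x - y|`: testing on the standard dyadic cubes
suffices. -/
theorem trace_inequality (μ : Measure R3) [SFinite μ] [NullSingletonClass μ] {A : ℝ≥0}
    (hfin : ∀ q, μ (dyadicCubeP q) ≠ ⊤)
    (hA : ∀ q, pairEnergy μ (dyadicCubeP q) (dyadicCubeP q) ≤ A * μ (dyadicCubeP q))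
    {g : R3 → ℝ≥0∞} (hg : Measurable g) (hg2 : ∫⁻ x, g x ^ 2 ∂μ ≠ ⊤) :
    ∫⁻ x, ∫⁻ y, g x * g y * ‖x - y‖ₑ⁻¹ ∂μ ∂μ ≤
      64 * neighbours.card * A * ∫⁻ x, g x ^ 2 ∂μ := by
  -- The energy bound is used for ν = g μ, whose cube masses are the integrals of g in the Carleson
  -- embedding; 64 is 4 · 16.
  have hna : NullSingletonClass (μ.withDensity g) :=
    ⟨fun x => withDensity_absolutelyContinuous μ g (measure_singleton x)⟩
  have h := energy_le_tsum (μ.withDensity g)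
  have e : ∫⁻ x, ∫⁻ y, ‖x - y‖ₑ⁻¹ ∂(μ.withDensity g) ∂(μ.withDensity g) =
      ∫⁻ x, ∫⁻ y, g x * g y * ‖x - y‖ₑ⁻¹ ∂μ ∂μ := by
    rw [lintegral_withDensity_eq_lintegral_mul _ hg (measurable_potential _)]
    congr 1; funext x
    rw [Pi.mul_apply, lintegral_withDensity_eq_lintegral_mul _ hg (by fun_prop),
      ← lintegral_const_mul _ (by fun_prop)]
    simp [mul_assoc]
  rw [e] at h
  simp only [fun k m => withDensity_apply g (measurableSet_dyadicCube k m) (μ := μ)] at h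
  calc _ ≤ _ := h
    _ ≤ 4 * neighbours.card * (16 * A * ∫⁻ x, g x ^ 2 ∂μ) := by
        gcongr; exact tsum_sideInv_lintegral_le μ hfin hA hg hg2
    _ = _ := by ring

/-! ### Spherical coordinates -/

/-- Cartesian coordinates with respect to an orthonormal basis. -/
noncomputable def cartesian (b : OrthonormalBasis (Fin 3) ℝ R3) (p : ℝ × ℝ × ℝ) : R3 :=
  p.1 • b 0 + (p.2.1 • b 1 + p.2.2 • b 2)

theorem continuous_cartesian (b : OrthonormalBasis (Fin 3) ℝ R3) : Continuous (cartesian b) := by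
  unfold cartesian; fun_prop

theorem norm_cartesian_sq (b : OrthonormalBasis (Fin 3) ℝ R3) (p : ℝ × ℝ × ℝ) :
    ‖cartesian b p‖ ^ 2 = p.1 ^ 2 + p.2.1 ^ 2 + p.2.2 ^ 2 := by
  have h : cartesian b p = ∑ i, (![p.1, p.2.1, p.2.2] : Fin 3 → ℝ) i • b i := by
    simp [Fin.sum_univ_three, cartesian, add_assoc]
  rw [h, ← real_inner_self_eq_norm_sq, b.orthonormal.inner_sum]
  simp [Fin.sum_univ_three]; ring

theorem measurePreserving_cartesian (b : OrthonormalBasis (Fin 3) ℝ R3) :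
    ∃ e : (ℝ × ℝ × ℝ) ≃ᵐ R3, (∀ p, e p = cartesian b p) ∧ MeasurePreserving e volume volume := by
  let e1 := (MeasurableEquiv.piFinSuccAbove (fun _ : Fin 3 => ℝ) 0).symm
  let e0 : (ℝ × ℝ × ℝ) ≃ᵐ (ℝ × (Fin 2 → ℝ)) :=
    MeasurableEquiv.prodCongr (MeasurableEquiv.refl ℝ) MeasurableEquiv.finTwoArrow.symm
  let e2 := MeasurableEquiv.toLp 2 (Fin 3 → ℝ)
  let e3 := b.measurableEquiv.symm
  refine ⟨((e0.trans e1).trans e2).trans e3, ?_, ?_⟩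
  · intro p
    change b.repr.symm _ = _
    rw [← OrthonormalBasis.sum_repr_symm, Fin.sum_univ_three, cartesian, add_assoc]
    rfl
  · have h0 : MeasurePreserving e0 volume volume :=
      (MeasurePreserving.id _).prod (volume_preserving_finTwoArrow ℝ).symm
    have h1 : MeasurePreserving e1 volume volume :=
      (volume_preserving_piFinSuccAbove (fun _ : Fin 3 => ℝ) 0).symm
    have h2 : MeasurePreserving e2 volume volume := PiLp.volume_preserving_toLp (Fin 3)
    have h3 : MeasurePreserving e3 volume volume := b.measurePreserving_measurableEquiv.symm
    exact h3.comp (h2.comp (h1.comp h0))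

theorem integral_cartesian (b : OrthonormalBasis (Fin 3) ℝ R3) (F : R3 → ℂ) :
    ∫ y, F y = ∫ p, F (cartesian b p) := by
  obtain ⟨e, he, hp⟩ := measurePreserving_cartesian b
  simp_rw [← he]
  exact (hp.integral_comp' F).symm

theorem integrable_cartesian (b : OrthonormalBasis (Fin 3) ℝ R3) {F : R3 → ℂ} (hF : Integrable F) :
    Integrable fun p => F (cartesian b p) := by
  obtain ⟨e, he, hp⟩ := measurePreserving_cartesian b
  simp_rw [← he]
  exact hp.integrable_comp_of_integrable hF

/-- The point with spherical coordinates `u, θ, φ`. -/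
noncomputable def spherical (b : OrthonormalBasis (Fin 3) ℝ R3) (u θ φ : ℝ) : R3 :=
  cartesian b (u * Real.cos θ, u * Real.sin θ * Real.cos φ, u * Real.sin θ * Real.sin φ)

theorem norm_spherical (b : OrthonormalBasis (Fin 3) ℝ R3) {u : ℝ} (hu : 0 ≤ u) (θ φ : ℝ) :
    ‖spherical b u θ φ‖ = u := by
  rw [← sq_eq_sq₀ (norm_nonneg _) hu, spherical, norm_cartesian_sq]
  linear_combination (u ^ 2 * Real.sin θ ^ 2) * Real.sin_sq_add_cos_sq φ +
    u ^ 2 * Real.sin_sq_add_cos_sq θ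

/-- Integration in cylindrical coordinates. -/
theorem integral_cylindrical (b : OrthonormalBasis (Fin 3) ℝ R3) {F : R3 → ℂ} (hF : Integrable F)
    (hFc : Continuous F) :
    ∫ y, F y = ∫ φ in Set.Ioo (-Real.pi) Real.pi,
      ∫ p : ℝ × ℝ in Set.univ ×ˢ Set.Ioi 0,
        p.2 • F (cartesian b (p.1, p.2 * Real.cos φ, p.2 * Real.sin φ)) := by
  set h : ℝ × ℝ × ℝ → ℂ := fun p =>
    p.2.1 • F (cartesian b (p.1, p.2.1 * Real.cos p.2.2, p.2.1 * Real.sin p.2.2)) with hh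
  have hcont : Continuous h := by
    have := continuous_cartesian b
    fun_prop
  have hG := integrable_cartesian b hF
  have hmeasure : (volume : Measure (ℝ × ℝ)).restrict polarCoord.target =
      (volume.restrict (Set.Ioi (0 : ℝ))).prod (volume.restrict (Set.Ioo (-Real.pi) Real.pi)) := by
    rw [polarCoord_target, Measure.prod_restrict]; rfl
  -- Polar coordinates for the integral of the norm give absolute integrability, which licenses
  -- moving the φ integral outermost.
  have hint : Integrable h (volume.prod
      ((volume.restrict (Set.Ioi (0 : ℝ))).prod
        (volume.restrict (Set.Ioo (-Real.pi) Real.pi)))) := by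
    refine ⟨hcont.aestronglyMeasurable, ?_⟩
    rw [← hmeasure, HasFiniteIntegral, lintegral_prod _ hcont.enorm.aemeasurable]
    have h2 := hG.2
    have hc : Continuous fun p : ℝ × ℝ × ℝ => ‖F (cartesian b p)‖ₑ :=
      (hFc.comp (continuous_cartesian b)).enorm
    rw [HasFiniteIntegral, Measure.volume_eq_prod, lintegral_prod _ hc.aemeasurable] at h2
    refine lt_of_le_of_lt (le_of_eq ?_) h2
    congr 1; funext s
    rw [← lintegral_comp_polarCoord_symm]
    refine setLIntegral_congr_fun polarCoord.open_target.measurableSet fun p hp => ?_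
    rw [polarCoord_target] at hp
    simp only [hh, polarCoord_symm_apply, smul_eq_mul, enorm_smul]
    rw [Real.enorm_eq_ofReal (le_of_lt hp.1)]
  rw [integral_cartesian b F, Measure.volume_eq_prod, integral_prod _ hG]
  calc ∫ s, ∫ q : ℝ × ℝ, F (cartesian b (s, q)) =
      ∫ s, ∫ q in polarCoord.target, h (s, q) := by
        congr 1; funext s
        rw [← integral_comp_polarCoord_symm]
        rfl
    _ = ∫ p, h p ∂(volume.prod ((volume.restrict (Set.Ioi (0 : ℝ))).prod
        (volume.restrict (Set.Ioo (-Real.pi) Real.pi)))) := by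
        rw [integral_prod _ hint, hmeasure]
    _ = ∫ p : (ℝ × ℝ) × ℝ, h (p.1.1, p.1.2, p.2) ∂((volume.prod
          (volume.restrict (Set.Ioi (0 : ℝ)))).prod
        (volume.restrict (Set.Ioo (-Real.pi) Real.pi))) := by
        rw [← (measurePreserving_prodAssoc volume (volume.restrict (Set.Ioi (0 : ℝ)))
          (volume.restrict (Set.Ioo (-Real.pi) Real.pi))).integral_comp'
          (f := MeasurableEquiv.prodAssoc)]
        rfl
    _ = _ := by
        have hint' := (measurePreserving_prodAssoc volume (volume.restrict (Set.Ioi (0 : ℝ)))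
          (volume.restrict (Set.Ioo (-Real.pi) Real.pi))).integrable_comp_of_integrable hint
        refine (integral_prod_symm _ hint').trans ?_
        congr 1; funext φ
        rw [Measure.volume_eq_prod ℝ ℝ, ← Measure.prod_restrict, Measure.restrict_univ]
        rfl

theorem sin_pos_iff_of_mem_Ioo {θ : ℝ} (h : θ ∈ Set.Ioo (-Real.pi) Real.pi) :
    0 < Real.sin θ ↔ 0 < θ := by
  constructor
  · intro h1
    by_contra h2
    have := Real.sin_nonpos_of_nonpos_of_neg_pi_le (not_lt.1 h2) h.1.le
    linarith
  · intro h1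
    exact Real.sin_pos_of_pos_of_lt_pi h1 h.2

/-- Estimating an integral through its inner polar integrals. -/
theorem norm_integral_le_of_polar_integral (b : OrthonormalBasis (Fin 3) ℝ R3) {F : R3 → ℂ}
    (hF : Integrable F) (hFc : Continuous F) {R D : ℝ} (hR : 0 ≤ R) (hD : 0 ≤ D)
    (hsupp : ∀ y, R < ‖y‖ → F y = 0)
    (hpolar : ∀ u φ, 0 < u → u ≤ R →
      u ^ 2 * ‖∫ θ in (0 : ℝ)..Real.pi, (Real.sin θ : ℂ) * F (spherical b u θ φ)‖ ≤ D) :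
    ‖∫ y, F y‖ ≤ 2 * Real.pi * (R * D) := by
  rw [integral_cylindrical b hF hFc]
  have hpi := Real.pi_pos
  have hvol : (volume (Set.Ioo (-Real.pi) Real.pi)) < ⊤ := by simp
  refine (norm_setIntegral_le_of_norm_le_const hvol (C := R * D) fun φ _ => ?_).trans ?_
  swap
  · rw [Real.volume_real_Ioo_of_le (by linarith)]; apply le_of_eq; ring
  -- A second polar change, in the half-plane of axial and radial coordinates. Extension by zero
  -- confines θ to (0, π), and the Jacobian u times the cylindrical weight u sin θ gives u² sin θ.
  rw [← integral_indicator (MeasurableSet.univ.prod measurableSet_Ioi),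
    ← integral_comp_polarCoord_symm]
  set K : ℝ × ℝ → ℂ := _
  change ‖∫ p in polarCoord.target, K p‖ ≤ R * D
  -- A non-integrable K has integral 0 by convention, so this case is trivial.
  by_cases hK : IntegrableOn K polarCoord.target
  swap
  · rw [integral_undef hK, norm_zero]; positivity
  have hval : ∀ u θ, 0 < u → θ ∈ Set.Ioo (-Real.pi) Real.pi → K (u, θ) =
      (Set.Ioo 0 Real.pi).indicator (fun θ => (u : ℂ) ^ 2 * ((Real.sin θ : ℂ) *
        F (spherical b u θ φ))) θ := by
    intro u θ hu hθ
    by_cases h : 0 < Real.sin θ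
    · have h1 : θ ∈ Set.Ioo 0 Real.pi := ⟨(sin_pos_iff_of_mem_Ioo hθ).1 h, hθ.2⟩
      have h2 : (u * Real.cos θ, u * Real.sin θ) ∈ (Set.univ : Set ℝ) ×ˢ Set.Ioi (0 : ℝ) :=
        ⟨trivial, mul_pos hu h⟩
      simp only [K, polarCoord_symm_apply]
      rw [Set.indicator_of_mem h1, Set.indicator_of_mem h2]
      simp only [spherical, Complex.real_smul]
      push_cast; ring
    · have h1 : θ ∉ Set.Ioo 0 Real.pi := fun h' => h ((sin_pos_iff_of_mem_Ioo hθ).2 h'.1)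
      have h2 : (u * Real.cos θ, u * Real.sin θ) ∉ (Set.univ : Set ℝ) ×ˢ Set.Ioi (0 : ℝ) :=
        fun h' => h (pos_of_mul_pos_right h'.2 hu.le)
      simp only [K, polarCoord_symm_apply]
      rw [Set.indicator_of_notMem h1, Set.indicator_of_notMem h2, smul_zero]
  have hnorm : ∀ u θ, 0 < u → ‖spherical b u θ φ‖ = u := fun u θ hu => norm_spherical b hu.le θ φ
  have hinner : ∀ u, 0 < u → ∫ θ in Set.Ioo (-Real.pi) Real.pi, K (u, θ) =
      (u : ℂ) ^ 2 * ∫ θ in (0 : ℝ)..Real.pi, (Real.sin θ : ℂ) * F (spherical b u θ φ) := by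
    intro u hu
    rw [setIntegral_congr_fun measurableSet_Ioo fun θ hθ => hval u θ hu hθ,
      setIntegral_indicator measurableSet_Ioo, ← intervalIntegral.integral_const_mul,
      intervalIntegral.integral_of_le hpi.le, integral_Ioc_eq_integral_Ioo]
    congr 2
    ext θ; simp only [Set.mem_inter_iff, Set.mem_Ioo]
    constructor
    · exact fun h => h.2
    · exact fun h => ⟨⟨by linarith [h.1], h.2⟩, h⟩
  rw [polarCoord_target] at hK ⊢
  rw [Measure.volume_eq_prod, setIntegral_prod _ hK,
    setIntegral_eq_of_subset_of_forall_sdiff_eq_zero measurableSet_Ioi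
      (s := Set.Ioc 0 R) (fun u hu => hu.1)]
  · refine (norm_setIntegral_le_of_norm_le_const (by simp) (C := D) fun u hu => ?_).trans ?_
    · rw [hinner u hu.1, norm_mul, norm_pow, Complex.norm_real, Real.norm_of_nonneg hu.1.le]
      exact hpolar u φ hu.1 hu.2
    · rw [Real.volume_real_Ioc_of_le hR]; apply le_of_eq; ring
  · intro u hu
    have hu0 : 0 < u := hu.1
    have huR : R < u := by
      by_contra h
      exact hu.2 ⟨hu0, not_lt.1 h⟩
    rw [hinner u hu0]
    have : ∀ θ, F (spherical b u θ φ) = 0 := fun θ => hsupp _ (by rw [hnorm u θ hu0]; exact huR)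
    simp [this]

/-! ### The oscillatory kernel -/

/-- The distance to a point of the axis, in spherical coordinates. -/
noncomputable def axisDist (u r θ : ℝ) : ℝ := Real.sqrt (u ^ 2 + r ^ 2 - 2 * u * r * Real.cos θ)

theorem axisDist_pos {u r θ : ℝ} (hu : 0 < u) (hr : 0 < r) (hθ : θ ∈ Set.Ioo 0 Real.pi) :
    0 < u ^ 2 + r ^ 2 - 2 * u * r * Real.cos θ := by
  have h : Real.cos θ < 1 := by
    rw [← Real.cos_zero]
    exact Real.cos_lt_cos_of_nonneg_of_le_pi le_rfl hθ.2.le hθ.1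
  have : 0 < u * r := by positivity
  nlinarith [sq_nonneg (u - r)]

theorem axisDist_le {u r : ℝ} (hu : 0 ≤ u) (hr : 0 ≤ r) (θ : ℝ) : axisDist u r θ ≤ u + r := by
  rw [axisDist, Real.sqrt_le_left (by positivity)]
  nlinarith [Real.neg_one_le_cos θ, mul_nonneg hu hr]

theorem continuous_axisDist (u r : ℝ) : Continuous (axisDist u r) := by
  unfold axisDist; fun_prop

theorem hasDerivAt_axisDist {u r θ : ℝ} (hu : 0 < u) (hr : 0 < r) (hθ : θ ∈ Set.Ioo 0 Real.pi) :
    HasDerivAt (axisDist u r) (u * r * Real.sin θ / axisDist u r θ) θ := by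
  have h := (((Real.hasDerivAt_cos θ).const_mul (2 * u * r)).const_sub (u ^ 2 + r ^ 2)).sqrt
    (axisDist_pos hu hr hθ).ne'
  refine h.congr_deriv ?_
  have : Real.sqrt (u ^ 2 + r ^ 2 - 2 * u * r * Real.cos θ) ≠ 0 :=
    (Real.sqrt_pos.2 (axisDist_pos hu hr hθ)).ne'
  unfold axisDist
  field_simp

/-- A primitive of `θ ↦ 2 u r sin θ e^{-i lam v(θ)}`, with `v` the distance to a point of the
axis. -/
noncomputable def axisPrimitive (lam u r θ : ℝ) : ℂ :=
  2 * (Complex.exp (-(Complex.I * lam * axisDist u r θ)) *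
    (Complex.I * axisDist u r θ / lam + 1 / (lam : ℂ) ^ 2))

theorem norm_exp_neg_I_mul (s t : ℝ) : ‖Complex.exp (-(Complex.I * s * t))‖ = 1 := by
  rw [Complex.norm_exp]; simp

theorem norm_axisPrimitive_le {lam u r : ℝ} (hlam : 1 ≤ |lam|) (hu : 0 ≤ u) (hr : 0 ≤ r) (θ : ℝ) :
    ‖axisPrimitive lam u r θ‖ ≤ 2 * (u + r + 1) / |lam| := by
  have hl : 0 < |lam| := by linarith
  rw [axisPrimitive, norm_mul, norm_mul, norm_exp_neg_I_mul, one_mul]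
  have h1 : ‖Complex.I * axisDist u r θ / lam + 1 / (lam : ℂ) ^ 2‖ ≤ (u + r) / |lam| + 1 / |lam| := by
    refine (norm_add_le _ _).trans (add_le_add ?_ ?_)
    · rw [norm_div, norm_mul, Complex.norm_I, one_mul, Complex.norm_real, Complex.norm_real,
        Real.norm_eq_abs, Real.norm_eq_abs, abs_of_nonneg (show 0 ≤ axisDist u r θ from Real.sqrt_nonneg _)]
      gcongr
      exact axisDist_le hu hr θ
    · rw [norm_div, norm_one, norm_pow, Complex.norm_real, Real.norm_eq_abs]
      gcongr
      nlinarith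
  calc _ ≤ ‖(2 : ℂ)‖ * ((u + r) / |lam| + 1 / |lam|) := by gcongr
    _ = _ := by rw [Complex.norm_ofNat]; ring

/-- The function e^{-iλv} (i v/λ + 1/λ²) is a primitive of v e^{-iλv} in v, and v dv/dθ = u r sin θ.
The factor v cancels, so nothing blows up where v is small. -/
theorem hasDerivAt_axisPrimitive {lam u r θ : ℝ} (hlam : lam ≠ 0) (hu : 0 < u) (hr : 0 < r)
    (hθ : θ ∈ Set.Ioo 0 Real.pi) :
    HasDerivAt (axisPrimitive lam u r)
      (2 * u * r * (Real.sin θ * Complex.exp (-(Complex.I * lam * axisDist u r θ)))) θ := by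
  have hv := (hasDerivAt_axisDist hu hr hθ).ofReal_comp
  have hv0 : (axisDist u r θ : ℂ) ≠ 0 := by
    have : axisDist u r θ ≠ 0 := (Real.sqrt_pos.2 (axisDist_pos hu hr hθ)).ne'
    exact_mod_cast this
  have hl : (lam : ℂ) ≠ 0 := by exact_mod_cast hlam
  have h1 := ((hv.const_mul (Complex.I * lam)).fun_neg).cexp
  have h2 := ((hv.const_mul Complex.I).div_const (lam : ℂ)).add_const (1 / (lam : ℂ) ^ 2)
  have h3 := (h1.mul h2).const_mul 2
  refine h3.congr_deriv ?_
  push_cast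
  field_simp
  linear_combination (-(u : ℂ) * r * Complex.sin θ * (axisDist u r θ) * lam) * Complex.I_sq

theorem continuous_axisPrimitive (lam u r : ℝ) : Continuous (axisPrimitive lam u r) := by
  have := continuous_axisDist u r
  unfold axisPrimitive
  fun_prop

/-- The polar integral, estimated by a single integration by parts. -/
theorem norm_polar_integral_le {lam u r : ℝ} (hlam : 1 ≤ |lam|) (hu : 0 < u) (hr : 0 < r)
    {β β' : ℝ → ℂ} (hβ : ∀ θ, HasDerivAt β (β' θ) θ) (hβ' : Continuous β') {M₀ M₁ : ℝ}
    (h₀ : ∀ θ, ‖β θ‖ ≤ M₀) (h₁ : ∀ θ, ‖β' θ‖ ≤ M₁) :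
    u * r * ‖∫ θ in (0 : ℝ)..Real.pi,
        (Real.sin θ : ℂ) * (Complex.exp (-(Complex.I * lam * axisDist u r θ)) * β θ)‖ ≤
      (2 * M₀ + Real.pi * M₁) * (u + r + 1) / |lam| := by
  have hpi := Real.pi_pos
  have hl : 0 < |lam| := by linarith
  have hM₀ : 0 ≤ M₀ := (norm_nonneg _).trans (h₀ 0)
  have hM₁ : 0 ≤ M₁ := (norm_nonneg _).trans (h₁ 0)
  have hβc : Continuous β := continuous_iff_continuousAt.2 fun θ => (hβ θ).continuousAt
  have hPc := continuous_axisPrimitive lam u r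
  have hvc := continuous_axisDist u r
  have hP := norm_axisPrimitive_le hlam hu.le hr.le
  set S := 2 * (u + r + 1) / |lam| with hS
  have hS0 : 0 ≤ S := by positivity
  -- Differentiability of the primitive is used only on the open interval: for u = r the distance
  -- vanishes at θ = 0, where continuity suffices.
  have ibp := intervalIntegral.integral_mul_deriv_eq_deriv_mul_of_hasDerivAt
    (a := 0) (b := Real.pi) (u := β) (u' := β') (v := axisPrimitive lam u r)
    (v' := fun θ => 2 * u * r * (Real.sin θ *
      Complex.exp (-(Complex.I * lam * axisDist u r θ))))
    hβc.continuousOn hPc.continuousOn (fun θ _ => hβ θ)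
    (fun θ hθ => by
      rw [min_eq_left hpi.le, max_eq_right hpi.le] at hθ
      exact hasDerivAt_axisPrimitive (abs_pos.1 hl) hu hr hθ)
    (hβ'.intervalIntegrable _ _) (Continuous.intervalIntegrable (by fun_prop) _ _)
  have e : ∫ θ in (0 : ℝ)..Real.pi, β θ * (2 * u * r * (Real.sin θ *
      Complex.exp (-(Complex.I * lam * axisDist u r θ)))) =
      2 * u * r * ∫ θ in (0 : ℝ)..Real.pi,
        (Real.sin θ : ℂ) * (Complex.exp (-(Complex.I * lam * axisDist u r θ)) * β θ) := by
    rw [← intervalIntegral.integral_const_mul]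
    congr 1; funext θ; ring
  rw [e] at ibp
  have hint : ‖∫ θ in (0 : ℝ)..Real.pi, β' θ * axisPrimitive lam u r θ‖ ≤
      M₁ * S * |Real.pi - 0| := by
    refine intervalIntegral.norm_integral_le_of_norm_le_const fun θ _ => ?_
    rw [norm_mul]
    exact mul_le_mul (h₁ θ) (hP θ) (norm_nonneg _) hM₁
  have hb : ∀ θ, ‖β θ * axisPrimitive lam u r θ‖ ≤ M₀ * S := fun θ => by
    rw [norm_mul]
    exact mul_le_mul (h₀ θ) (hP θ) (norm_nonneg _) hM₀
  have hn := congrArg norm ibp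
  rw [norm_mul, norm_mul, norm_mul, Complex.norm_ofNat, Complex.norm_real, Complex.norm_real,
    Real.norm_of_nonneg hu.le, Real.norm_of_nonneg hr.le] at hn
  rw [sub_zero, abs_of_pos hpi] at hint
  have hle := (norm_sub_le (β Real.pi * axisPrimitive lam u r Real.pi -
    β 0 * axisPrimitive lam u r 0) (∫ θ in (0 : ℝ)..Real.pi, β' θ * axisPrimitive lam u r θ)).trans
      (add_le_add (norm_sub_le _ _) le_rfl)
  have h1 := hb Real.pi
  have h2 := hb 0
  have h3 : (2 * M₀ + Real.pi * M₁) * (u + r + 1) / |lam| =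
      (M₀ * S + M₀ * S + M₁ * S * Real.pi) / 2 := by rw [hS]; ring
  rw [h3]
  linarith

theorem exists_orthonormalBasis_axis {e : R3} (he : ‖e‖ = 1) :
    ∃ b : OrthonormalBasis (Fin 3) ℝ R3, b 0 = e := by
  have hv : Orthonormal ℝ (({0} : Set (Fin 3)).domRestrict fun _ => e) := by
    refine ⟨fun _ => he, fun i j h => ?_⟩
    exact absurd (Subsingleton.elim i j) h
  obtain ⟨b, hb⟩ := hv.exists_orthonormalBasis_extension_of_card_eq (by simp)
  exact ⟨b, hb 0 rfl⟩

theorem norm_spherical_sub_axis (b : OrthonormalBasis (Fin 3) ℝ R3) (u r θ φ : ℝ) :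
    ‖spherical b u θ φ - r • b 0‖ = axisDist u r θ := by
  have h : spherical b u θ φ - r • b 0 = cartesian b (u * Real.cos θ - r,
      u * Real.sin θ * Real.cos φ, u * Real.sin θ * Real.sin φ) := by
    simp only [spherical, cartesian, sub_smul]; abel
  rw [h, axisDist, ← Real.sqrt_sq (norm_nonneg _), norm_cartesian_sq]
  congr 1
  linear_combination (u ^ 2 * Real.sin θ ^ 2) * Real.sin_sq_add_cos_sq φ +
    u ^ 2 * Real.sin_sq_add_cos_sq θ

theorem hasDerivAt_spherical (b : OrthonormalBasis (Fin 3) ℝ R3) (u θ φ : ℝ) :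
    HasDerivAt (fun θ => spherical b u θ φ)
      (cartesian b (-(u * Real.sin θ), u * Real.cos θ * Real.cos φ,
        u * Real.cos θ * Real.sin φ)) θ := by
  unfold spherical cartesian
  have hc := ((Real.hasDerivAt_cos θ).const_mul u)
  have hs := ((Real.hasDerivAt_sin θ).const_mul u)
  refine ((hc.smul_const (b 0)).add (((hs.mul_const (Real.cos φ)).smul_const (b 1)).add
    ((hs.mul_const (Real.sin φ)).smul_const (b 2)))).congr_deriv ?_
  simp only [mul_neg]

theorem norm_spherical_deriv (b : OrthonormalBasis (Fin 3) ℝ R3) {u : ℝ} (hu : 0 ≤ u) (θ φ : ℝ) :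
    ‖cartesian b (-(u * Real.sin θ), u * Real.cos θ * Real.cos φ,
        u * Real.cos θ * Real.sin φ)‖ = u := by
  rw [← sq_eq_sq₀ (norm_nonneg _) hu, norm_cartesian_sq]
  linear_combination (u ^ 2 * Real.cos θ ^ 2) * Real.sin_sq_add_cos_sq φ +
    u ^ 2 * Real.sin_sq_add_cos_sq θ

/-- The decay of the oscillatory kernel of `T T*`. -/
theorem norm_osc_kernel_le {lam : ℝ} (hlam : 1 ≤ |lam|) {x z : R3} (hxz : x ≠ z)
    (hr4 : ‖x - z‖ ≤ 4) {c : R3 → ℂ} (hc : ContDiff ℝ 1 c) {M₀ : ℝ} {M₁ : ℝ≥0}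
    (h₀ : ∀ y, ‖c y‖ ≤ M₀) (h₁ : LipschitzWith M₁ c) (hsupp : ∀ y, 2 < ‖x - y‖ → c y = 0) :
    ‖∫ y, Complex.exp (Complex.I * lam * ‖x - y‖) *
        (Complex.exp (-(Complex.I * lam * ‖z - y‖)) * c y)‖ ≤
      56 * Real.pi * (2 * M₀ + 2 * Real.pi * M₁) / (|lam| * ‖x - z‖) := by
  have hpi := Real.pi_pos
  have hl : 0 < |lam| := by linarith
  have hM₀ : 0 ≤ M₀ := (norm_nonneg _).trans (h₀ 0)
  set r := ‖x - z‖ with hr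
  have hr0 : 0 < r := norm_pos_iff.2 (sub_ne_zero.2 hxz)
  -- The axis points from x to z, so |x-y| is constant on the spheres of integration and |z-y|
  -- depends only on u and θ.
  obtain ⟨b, hb⟩ := exists_orthonormalBasis_axis (e := r⁻¹ • (z - x)) (by
    rw [norm_smul, norm_inv, Real.norm_of_nonneg hr0.le, norm_sub_rev, ← hr,
      inv_mul_cancel₀ hr0.ne'])
  have hzx : z = x + r • b 0 := by rw [hb, smul_smul, mul_inv_cancel₀ hr0.ne']; simp
  rw [← integral_add_left_eq_self _ x]
  set F : R3 → ℂ := fun y => Complex.exp (Complex.I * lam * ‖x - (x + y)‖) *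
        (Complex.exp (-(Complex.I * lam * ‖z - (x + y)‖)) * c (x + y)) with hF
  have hcc := hc.continuous
  have hFc : Continuous F := by fun_prop
  have hFs : ∀ y, 2 < ‖y‖ → F y = 0 := by
    intro y hy
    simp only [hF]
    rw [hsupp (x + y) (by simpa using hy)]; simp
  have hFi : Integrable F := by
    refine hFc.integrable_of_hasCompactSupport
      (HasCompactSupport.intro (isCompact_closedBall (0 : R3) 2) fun y hy => hFs y ?_)
    simpa using hy
  -- From u ≤ 2 and r ≤ 4 come u + r + 1 ≤ 7 and 14 = 2 · 7; then 2π · 2 · 14 = 56π.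
  set D := 14 * (2 * M₀ + 2 * Real.pi * M₁) / (|lam| * r) with hD
  have hD0 : 0 ≤ D := by positivity
  refine (norm_integral_le_of_polar_integral b hFi hFc (R := 2) (D := D) (by norm_num) hD0
    hFs fun u φ hu hu2 => ?_).trans (le_of_eq (by rw [hD]; ring))
  have hdist : ∀ θ, ‖z - (x + spherical b u θ φ)‖ = axisDist u r θ := by
    intro θ
    rw [← norm_spherical_sub_axis b u r θ φ, hzx, norm_sub_rev]
    congr 1; abel
  set γ' : ℝ → R3 := fun θ => cartesian b (-(u * Real.sin θ), u * Real.cos θ * Real.cos φ,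
        u * Real.cos θ * Real.sin φ) with hγ'
  have hβ : ∀ θ, HasDerivAt (fun θ => c (x + spherical b u θ φ))
      (fderiv ℝ c (x + spherical b u θ φ) (γ' θ)) θ := by
    intro θ
    have h1 : HasDerivAt (fun θ => x + spherical b u θ φ) (γ' θ) θ :=
      (hasDerivAt_spherical b u θ φ).const_add x
    exact ((hc.differentiable one_ne_zero _).hasFDerivAt).comp_hasDerivAt θ h1
  have hsc : Continuous fun θ => spherical b u θ φ :=
    continuous_iff_continuousAt.2 fun θ => (hasDerivAt_spherical b u θ φ).continuousAt
  have hγc : Continuous γ' := by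
    have := continuous_cartesian b
    fun_prop
  have hβ' : Continuous fun θ => fderiv ℝ c (x + spherical b u θ φ) (γ' θ) :=
    ((hc.continuous_fderiv one_ne_zero).comp (continuous_const.add hsc)).clm_apply hγc
  have hβ1 : ∀ θ, ‖fderiv ℝ c (x + spherical b u θ φ) (γ' θ)‖ ≤ 2 * M₁ := by
    intro θ
    refine (ContinuousLinearMap.le_opNorm _ _).trans ?_
    rw [hγ', norm_spherical_deriv b hu.le, mul_comm]
    exact mul_le_mul hu2 (norm_fderiv_le_of_lipschitz ℝ h₁) (norm_nonneg _) (by norm_num)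
  have key := norm_polar_integral_le hlam hu hr0 hβ hβ' (fun θ => h₀ _) hβ1
  have e : ∫ θ in (0 : ℝ)..Real.pi, (Real.sin θ : ℂ) * F (spherical b u θ φ) =
      Complex.exp (Complex.I * lam * u) * ∫ θ in (0 : ℝ)..Real.pi, (Real.sin θ : ℂ) *
        (Complex.exp (-(Complex.I * lam * axisDist u r θ)) * c (x + spherical b u θ φ)) := by
    rw [← intervalIntegral.integral_const_mul]
    congr 1; funext θ
    simp only [hF, hdist, sub_add_cancel_left, norm_neg, norm_spherical b hu.le]
    ring
  have hexp : ‖Complex.exp (Complex.I * lam * u)‖ = 1 := by rw [Complex.norm_exp]; simp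
  rw [e, norm_mul, hexp, one_mul]
  set J := ‖∫ θ in (0 : ℝ)..Real.pi, (Real.sin θ : ℂ) *
        (Complex.exp (-(Complex.I * lam * axisDist u r θ)) * c (x + spherical b u θ φ))‖
  have hJ : 0 ≤ J := norm_nonneg _
  rw [hD, le_div_iff₀ (by positivity)]
  rw [le_div_iff₀ hl] at key
  have hE : 0 ≤ 2 * M₀ + 2 * Real.pi * M₁ := by positivity
  calc u ^ 2 * J * (|lam| * r) = u * (u * r * J * |lam|) := by ring
    _ ≤ 2 * ((2 * M₀ + Real.pi * (2 * M₁)) * (u + r + 1)) := by gcongr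
    _ ≤ 2 * ((2 * M₀ + Real.pi * (2 * M₁)) * 7) := by gcongr; linarith
    _ = _ := by ring

/-! ### The `T T*` argument -/

open scoped ComplexConjugate

section Duality

variable {μ : Measure R3} [SFinite μ] {k : R3 → R3 → ℂ} {M₀ n : ℝ}

theorem integrable_indicator_ball {s : Set R3} (hs : MeasurableSet s) {ν : Measure R3}
    (hfin : ν s ≠ ⊤) (C : ℝ) : Integrable (s.indicator fun _ => C) ν :=
  (integrable_indicator_iff hs).2 (integrableOn_const hfin)

/-- A product majorant with bounded support, which makes the Fubini exchanges legitimate. -/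
theorem norm_mul_le_indicator (hk : ∀ x y, ‖k x y‖ ≤ M₀)
    (hsupp : ∀ x y, 2 < ‖x - y‖ → k x y = 0) {g : R3 → ℂ} (hn : 0 ≤ n) (hgb : ∀ x, ‖g x‖ ≤ n)
    (hgs : ∀ x, n < ‖x‖ → g x = 0) (x y : R3) :
    ‖k x y * conj (g x)‖ ≤ (Metric.closedBall (0 : R3) n).indicator (fun _ => M₀ * n) x *
      (Metric.closedBall (0 : R3) (n + 2)).indicator (fun _ => 1) y := by
  have hM : 0 ≤ M₀ := (norm_nonneg _).trans (hk 0 0)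
  by_cases hx : n < ‖x‖
  · rw [hgs x hx]
    simp only [map_zero, mul_zero, norm_zero]
    exact mul_nonneg (Set.indicator_nonneg (fun _ _ => by positivity) _)
      (Set.indicator_nonneg (fun _ _ => zero_le_one) _)
  by_cases hxy : 2 < ‖x - y‖
  · rw [hsupp x y hxy]
    simp only [zero_mul, norm_zero]
    exact mul_nonneg (Set.indicator_nonneg (fun _ _ => by positivity) _)
      (Set.indicator_nonneg (fun _ _ => zero_le_one) _)
  rw [not_lt] at hx hxy
  have hy : ‖y‖ ≤ n + 2 := by
    calc ‖y‖ = ‖x - (x - y)‖ := by rw [sub_sub_cancel]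
      _ ≤ ‖x‖ + ‖x - y‖ := norm_sub_le _ _
      _ ≤ n + 2 := add_le_add hx hxy
  rw [Set.indicator_of_mem (by simpa using hx), Set.indicator_of_mem (by simpa using hy), mul_one,
    norm_mul, RCLike.norm_conj]
  exact mul_le_mul (hk x y) (hgb x) (norm_nonneg _) hM

/-- The bound for the adjoint, from the kernel bound and the trace inequality. -/
theorem lintegral_adjoint_le (hkc : Continuous fun p : R3 × R3 => k p.1 p.2)
    (hk : ∀ x y, ‖k x y‖ ≤ M₀) (hsupp : ∀ x y, 2 < ‖x - y‖ → k x y = 0) {D B : ℝ≥0∞}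
    (hK : ∀ x z, ‖∫ y, k x y * conj (k z y)‖ₑ ≤ D * ‖x - z‖ₑ⁻¹)
    {g : R3 → ℂ} (hg : StronglyMeasurable g) (hn : 0 ≤ n) (hgb : ∀ x, ‖g x‖ ≤ n)
    (hgs : ∀ x, n < ‖x‖ → g x = 0) (hfin : μ (Metric.closedBall 0 n) ≠ ⊤)
    (hT : ∫⁻ x, ∫⁻ z, ‖g x‖ₑ * ‖g z‖ₑ * ‖x - z‖ₑ⁻¹ ∂μ ∂μ ≤ B * ∫⁻ x, ‖g x‖ₑ ^ 2 ∂μ) :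
    ∫⁻ y, ‖∫ x, k x y * conj (g x) ∂μ‖ₑ ^ 2 ≤ D * (B * ∫⁻ x, ‖g x‖ₑ ^ 2 ∂μ) := by
  have hgm := hg.measurable
  have hkm : Measurable fun p : R3 × R3 => k p.1 p.2 := hkc.measurable
  set φ : R3 → R3 → ℂ := fun x y => k x y * conj (g x) with hφ
  have hφm : Measurable fun p : R3 × R3 => φ p.1 p.2 :=
    hkm.mul (Complex.continuous_conj.measurable.comp (hgm.comp measurable_fst))
  -- Integrating Φ over the pair gives the squared modulus of the adjoint; integrating over y first
  -- gives the T T* kernel. Fubini equates the two.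
  set Φ : R3 × (R3 × R3) → ℂ := fun p => φ p.2.1 p.1 * conj (φ p.2.2 p.1) with hΦ
  have hΦm : Measurable Φ :=
    (hφm.comp ((measurable_fst.comp measurable_snd).prodMk measurable_fst)).mul
      (Complex.continuous_conj.measurable.comp
        (hφm.comp ((measurable_snd.comp measurable_snd).prodMk measurable_fst)))
  have hMn : 0 ≤ M₀ * n := mul_nonneg ((norm_nonneg _).trans (hk 0 0)) hn
  have hΦi : Integrable Φ (volume.prod (μ.prod μ)) := by
    have i1 := integrable_indicator_ball (ν := μ) (Metric.isClosed_closedBall.measurableSet)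
      hfin (M₀ * n)
    have i2 := integrable_indicator_ball (ν := volume) (s := Metric.closedBall (0 : R3) (n + 2))
      (Metric.isClosed_closedBall.measurableSet) measure_closedBall_lt_top.ne 1
    refine (i2.mul_prod (i1.mul_prod i1)).mono' hΦm.aestronglyMeasurable
      (Filter.Eventually.of_forall fun p => ?_)
    have h1 := norm_mul_le_indicator hk hsupp hn hgb hgs p.2.1 p.1
    have h2 := norm_mul_le_indicator hk hsupp hn hgb hgs p.2.2 p.1
    simp only [hΦ]
    rw [norm_mul, RCLike.norm_conj]
    refine (mul_le_mul h1 h2 (norm_nonneg _) ((norm_nonneg _).trans h1)).trans (le_of_eq ?_)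
    by_cases hy : p.1 ∈ Metric.closedBall (0 : R3) (n + 2)
    · simp only [Set.indicator_of_mem hy]; ring
    · simp only [Set.indicator_of_notMem hy]; ring
  have hsq : ∀ y, ∫ q, Φ (y, q) ∂(μ.prod μ) = ((‖∫ x, φ x y ∂μ‖ ^ 2 : ℝ) : ℂ) := by
    intro y
    simp only [hΦ]
    rw [integral_prod_mul (fun x => φ x y) (fun x => conj (φ x y)), integral_conj,
      Complex.mul_conj, Complex.normSq_eq_norm_sq]
  have hint : Integrable (fun y => ‖∫ x, φ x y ∂μ‖ ^ 2) := by
    have := hΦi.integral_prod_left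
    simp only [hsq] at this
    simpa only [RCLike.re_to_complex, Complex.ofReal_re] using this.re
  have e1 : ∫⁻ y, ‖∫ x, φ x y ∂μ‖ₑ ^ 2 = ‖∫ y, ∫ q, Φ (y, q) ∂(μ.prod μ)‖ₑ := by
    simp only [hsq]
    rw [integral_complex_ofReal, ← ofReal_norm, Complex.norm_real,
      Real.norm_of_nonneg (integral_nonneg fun y => sq_nonneg _),
      ofReal_integral_eq_lintegral_ofReal hint (Filter.Eventually.of_forall fun y => sq_nonneg _)]
    congr 1; funext y
    rw [ENNReal.ofReal_pow (norm_nonneg _), ofReal_norm]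
  have e2 : ∀ q : R3 × R3, ∫ y, Φ (y, q) =
      conj (g q.1) * g q.2 * ∫ y, k q.1 y * conj (k q.2 y) := by
    intro q
    rw [← integral_const_mul]
    congr 1; funext y
    simp only [hΦ, hφ, map_mul, Complex.conj_conj]
    ring
  rw [e1, integral_integral_swap (f := fun y q => Φ (y, q)) hΦi]
  refine (enorm_integral_le_lintegral_enorm _).trans ?_
  calc ∫⁻ q, ‖∫ y, Φ (y, q)‖ₑ ∂(μ.prod μ)
      ≤ ∫⁻ q, D * (‖g q.1‖ₑ * ‖g q.2‖ₑ * ‖q.1 - q.2‖ₑ⁻¹) ∂(μ.prod μ) := by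
        refine lintegral_mono fun q => ?_
        rw [e2, enorm_mul, enorm_mul, RCLike.enorm_conj]
        calc _ ≤ ‖g q.1‖ₑ * ‖g q.2‖ₑ * (D * ‖q.1 - q.2‖ₑ⁻¹) := by gcongr; exact hK _ _
          _ = _ := by ring
    _ = D * ∫⁻ x, ∫⁻ z, ‖g x‖ₑ * ‖g z‖ₑ * ‖x - z‖ₑ⁻¹ ∂μ ∂μ := by
        have hm : Measurable fun q : R3 × R3 => ‖g q.1‖ₑ * ‖g q.2‖ₑ * ‖q.1 - q.2‖ₑ⁻¹ := by
          fun_prop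
        rw [lintegral_const_mul _ hm, lintegral_prod _ hm.aemeasurable]
    _ ≤ _ := by gcongr

theorem lintegral_mul_le_sqrt {α : Type*} [MeasurableSpace α] (ν : Measure α) {F G : α → ℝ≥0∞}
    (hF : AEMeasurable F ν) (hG : AEMeasurable G ν) :
    (∫⁻ y, F y * G y ∂ν) ^ 2 ≤ (∫⁻ y, F y ^ 2 ∂ν) * ∫⁻ y, G y ^ 2 ∂ν := by
  have h := ENNReal.lintegral_mul_le_Lp_mul_Lq ν Real.HolderConjugate.two_two hF hG
  simp only [Pi.mul_apply, ENNReal.rpow_two] at h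
  calc _ ≤ ((∫⁻ y, F y ^ 2 ∂ν) ^ (1 / 2 : ℝ) * (∫⁻ y, G y ^ 2 ∂ν) ^ (1 / 2 : ℝ)) ^ 2 := by gcongr
    _ = _ := by
      rw [mul_pow, ← ENNReal.rpow_natCast, ← ENNReal.rpow_natCast, ← ENNReal.rpow_mul,
        ← ENNReal.rpow_mul]
      norm_num

/-- The bound on the part of the domain where the operator is under control. -/
theorem setLIntegral_operator_le (hkc : Continuous fun p : R3 × R3 => k p.1 p.2)
    (hk : ∀ x y, ‖k x y‖ ≤ M₀) (hsupp : ∀ x y, 2 < ‖x - y‖ → k x y = 0) {D B : ℝ≥0∞}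
    (hK : ∀ x z, ‖∫ y, k x y * conj (k z y)‖ₑ ≤ D * ‖x - z‖ₑ⁻¹)
    (hT : ∀ g : R3 → ℝ≥0∞, Measurable g → ∫⁻ x, g x ^ 2 ∂μ ≠ ⊤ →
      ∫⁻ x, ∫⁻ z, g x * g z * ‖x - z‖ₑ⁻¹ ∂μ ∂μ ≤ B * ∫⁻ x, g x ^ 2 ∂μ)
    (hn : 0 ≤ n) (hfin : μ (Metric.closedBall 0 n) ≠ ⊤)
    {f : R3 → ℂ} (hf : StronglyMeasurable f) (hf2 : MemLp f 2 volume) :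
    ∫⁻ x in {x | ‖x‖ ≤ n ∧ ‖∫ y, k x y * f y‖ ≤ n}, ‖∫ y, k x y * f y‖ₑ ^ 2 ∂μ ≤
      D * B * ∫⁻ y, ‖f y‖ₑ ^ 2 := by
  have hkm : Measurable fun p : R3 × R3 => k p.1 p.2 := hkc.measurable
  set h : R3 → ℂ := fun x => ∫ y, k x y * f y with hh
  have hhm : StronglyMeasurable h := by
    refine StronglyMeasurable.integral_prod_right' (f := fun p : R3 × R3 => k p.1 p.2 * f p.2) ?_
    exact (hkm.mul (hf.measurable.comp measurable_snd)).stronglyMeasurable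
  -- Truncating both the point and the value makes G finite before any bound on the operator is
  -- known, so G can be cancelled at the end.
  set E : Set R3 := {x | ‖x‖ ≤ n ∧ ‖h x‖ ≤ n} with hE
  have hEm : MeasurableSet E :=
    (measurableSet_le measurable_norm measurable_const).inter
      (measurableSet_le hhm.measurable.norm measurable_const)
  set g : R3 → ℂ := E.indicator h with hg
  have hgm : StronglyMeasurable g := hhm.indicator hEm
  have hgb : ∀ x, ‖g x‖ ≤ n := by
    intro x
    by_cases hx : x ∈ E
    · rw [hg, Set.indicator_of_mem hx]; exact hx.2
    · rw [hg, Set.indicator_of_notMem hx, norm_zero]; exact hn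
  have hgs : ∀ x, n < ‖x‖ → g x = 0 := fun x hx =>
    Set.indicator_of_notMem (fun hx' => not_lt.2 hx'.1 hx) _
  have hgE : ∀ x, ‖g x‖ₑ ^ 2 = E.indicator (fun x => ‖h x‖ₑ ^ 2) x := by
    intro x
    by_cases hx : x ∈ E
    · rw [hg, Set.indicator_of_mem hx, Set.indicator_of_mem hx]
    · rw [hg, Set.indicator_of_notMem hx, Set.indicator_of_notMem hx]; simp
  set G := ∫⁻ x, ‖g x‖ₑ ^ 2 ∂μ with hG
  have hGE : ∫⁻ x in E, ‖h x‖ₑ ^ 2 ∂μ = G := by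
    rw [hG, ← lintegral_indicator hEm]; simp only [hgE]
  rw [hGE]
  have hGbound : G ≤ ENNReal.ofReal n ^ 2 * μ (Metric.closedBall 0 n) := by
    rw [← hGE]
    calc ∫⁻ x in E, ‖h x‖ₑ ^ 2 ∂μ ≤ ∫⁻ _ in E, ENNReal.ofReal n ^ 2 ∂μ := by
          refine setLIntegral_mono' hEm fun x hx => ?_
          gcongr
          rw [← ofReal_norm]
          exact ENNReal.ofReal_le_ofReal hx.2
      _ = ENNReal.ofReal n ^ 2 * μ E := setLIntegral_const _ _
      _ ≤ _ := by
          gcongr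
          intro x hx
          simpa using hx.1
  have hGfin : G ≠ ⊤ := ne_top_of_le_ne_top (ENNReal.mul_ne_top (by simp) hfin) hGbound
  have hS := lintegral_adjoint_le hkc hk hsupp hK hgm hn hgb hgs hfin
    (hT (fun x => ‖g x‖ₑ) hgm.measurable.enorm hGfin)
  set S : R3 → ℂ := fun y => ∫ x, k x y * conj (g x) ∂μ with hSdef
  have hSm : StronglyMeasurable S := by
    refine StronglyMeasurable.integral_prod_right'
      (f := fun p : R3 × R3 => k p.2 p.1 * conj (g p.2)) ?_
    exact ((hkm.comp (measurable_snd.prodMk measurable_fst)).mul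
      (Complex.continuous_conj.measurable.comp
        (hgm.measurable.comp measurable_snd))).stronglyMeasurable
  have hΨi : Integrable (fun p : R3 × R3 => k p.1 p.2 * f p.2 * conj (g p.1))
      (μ.prod volume) := by
    have i1 := integrable_indicator_ball (ν := μ) (Metric.isClosed_closedBall.measurableSet)
      hfin (M₀ * n)
    have i2 : Integrable ((Metric.closedBall (0 : R3) (n + 2)).indicator fun y => ‖f y‖) := by
      refine (integrable_indicator_iff Metric.isClosed_closedBall.measurableSet).2 ?_
      have : IsFiniteMeasure (volume.restrict (Metric.closedBall (0 : R3) (n + 2))) :=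
        ⟨by rw [Measure.restrict_apply_univ]; exact measure_closedBall_lt_top⟩
      exact ((hf2.restrict _).integrable one_le_two).norm
    refine (i1.mul_prod i2).mono' ?_ (Filter.Eventually.of_forall fun p => ?_)
    · exact ((hkm.mul (hf.measurable.comp measurable_snd)).mul
        (Complex.continuous_conj.measurable.comp
          (hgm.measurable.comp measurable_fst))).aestronglyMeasurable
    · have h1 := norm_mul_le_indicator hk hsupp hn hgb hgs p.1 p.2
      calc ‖k p.1 p.2 * f p.2 * conj (g p.1)‖ = ‖k p.1 p.2 * conj (g p.1)‖ * ‖f p.2‖ := by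
            simp only [norm_mul]; ring
        _ ≤ _ := mul_le_mul_of_nonneg_right h1 (norm_nonneg _)
        _ = _ := by
            by_cases hy : p.2 ∈ Metric.closedBall (0 : R3) (n + 2)
            · simp only [Set.indicator_of_mem hy]; ring
            · simp only [Set.indicator_of_notMem hy]; ring
  have hswap := integral_integral_swap (f := fun x y => k x y * f y * conj (g x)) hΨi
  have e1 : ∀ x, ∫ y, k x y * f y * conj (g x) = ((‖g x‖ ^ 2 : ℝ) : ℂ) := by
    intro x
    rw [integral_mul_const]
    change h x * conj (g x) = _
    by_cases hx : x ∈ E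
    · rw [hg, Set.indicator_of_mem hx, Complex.mul_conj, Complex.normSq_eq_norm_sq]
    · rw [hg, Set.indicator_of_notMem hx]; simp
  have e2 : ∀ y, ∫ x, k x y * f y * conj (g x) ∂μ = f y * S y := by
    intro y
    rw [hSdef, ← integral_const_mul]
    congr 1; funext x; ring
  have hgi : Integrable (fun x => ‖g x‖ ^ 2) μ := by
    have := hΨi.integral_prod_left
    simp only [e1] at this
    simpa only [RCLike.re_to_complex, Complex.ofReal_re] using this.re
  simp only [e1, e2] at hswap
  -- Duality: G is the pairing of h with its truncation g, which Fubini turns into the pairing of f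
  -- with S.
  have hGle : G ≤ ∫⁻ y, ‖f y‖ₑ * ‖S y‖ₑ := by
    have e3 : G = ‖∫ x, ((‖g x‖ ^ 2 : ℝ) : ℂ) ∂μ‖ₑ := by
      rw [integral_complex_ofReal, ← ofReal_norm, Complex.norm_real,
        Real.norm_of_nonneg (integral_nonneg fun y => sq_nonneg _),
        ofReal_integral_eq_lintegral_ofReal hgi (Filter.Eventually.of_forall fun y => sq_nonneg _), hG]
      congr 1; funext y
      rw [ENNReal.ofReal_pow (norm_nonneg _), ofReal_norm]
    rw [e3, hswap]
    refine (enorm_integral_le_lintegral_enorm _).trans (le_of_eq ?_)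
    simp only [enorm_mul]
  have hfinal : G * G ≤ (D * B * ∫⁻ y, ‖f y‖ₑ ^ 2) * G := by
    calc G * G = G ^ 2 := (sq G).symm
      _ ≤ (∫⁻ y, ‖f y‖ₑ * ‖S y‖ₑ) ^ 2 := by gcongr
      _ ≤ (∫⁻ y, ‖f y‖ₑ ^ 2) * ∫⁻ y, ‖S y‖ₑ ^ 2 := lintegral_mul_le_sqrt _
          hf.measurable.enorm.aemeasurable hSm.measurable.enorm.aemeasurable
      _ ≤ (∫⁻ y, ‖f y‖ₑ ^ 2) * (D * (B * G)) := by gcongr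
      _ = _ := by ring
  rcases eq_or_ne G 0 with h0 | h0
  · rw [h0]; exact zero_le
  · exact (ENNReal.mul_le_mul_iff_left h0 hGfin).1 hfinal

/-- The weighted bound for an operator with compactly supported kernel. -/
theorem lintegral_operator_le (hkc : Continuous fun p : R3 × R3 => k p.1 p.2)
    (hk : ∀ x y, ‖k x y‖ ≤ M₀) (hsupp : ∀ x y, 2 < ‖x - y‖ → k x y = 0) {D B : ℝ≥0∞}
    (hK : ∀ x z, ‖∫ y, k x y * conj (k z y)‖ₑ ≤ D * ‖x - z‖ₑ⁻¹)
    (hT : ∀ g : R3 → ℝ≥0∞, Measurable g → ∫⁻ x, g x ^ 2 ∂μ ≠ ⊤ →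
      ∫⁻ x, ∫⁻ z, g x * g z * ‖x - z‖ₑ⁻¹ ∂μ ∂μ ≤ B * ∫⁻ x, g x ^ 2 ∂μ)
    (hfin : ∀ R : ℝ, μ (Metric.closedBall 0 R) ≠ ⊤)
    {f : R3 → ℂ} (hf : StronglyMeasurable f) (hf2 : MemLp f 2 volume) :
    ∫⁻ x, ‖∫ y, k x y * f y‖ₑ ^ 2 ∂μ ≤ D * B * ∫⁻ y, ‖f y‖ₑ ^ 2 := by
  set h : R3 → ℂ := fun x => ∫ y, k x y * f y with hh
  have hU : ⋃ N : ℕ, {x | ‖x‖ ≤ N ∧ ‖h x‖ ≤ N} = Set.univ := by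
    refine Set.eq_univ_of_forall fun x => ?_
    obtain ⟨N, hN⟩ := exists_nat_ge (max ‖x‖ ‖h x‖)
    exact Set.mem_iUnion.2 ⟨N, (le_max_left _ _).trans hN, (le_max_right _ _).trans hN⟩
  rw [← setLIntegral_univ, ← hU, setLIntegral_iUnion_of_directed]
  · exact iSup_le fun N => setLIntegral_operator_le hkc hk hsupp hK hT N.cast_nonneg (hfin N) hf hf2
  · refine Monotone.directed_le fun N N' hN x hx => ?_
    have : (N : ℝ) ≤ N' := by exact_mod_cast hN
    exact ⟨hx.1.trans this, hx.2.trans this⟩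

end Duality

/-! ### The class `F` and the weight -/

theorem dyadicCube_subset_closedBall (k : ℤ) (m : Fin 3 → ℤ) :
    ∃ R : ℝ, dyadicCube k m ⊆ Metric.closedBall 0 R := by
  rcases (dyadicCube k m).eq_empty_or_nonempty with h | ⟨x₀, hx₀⟩
  · exact ⟨0, by simp [h]⟩
  · refine ⟨2 * (2 : ℝ) ^ k + ‖x₀‖, fun x hx => ?_⟩
    rw [mem_closedBall_zero_iff]
    calc ‖x‖ = ‖(x - x₀) + x₀‖ := by rw [sub_add_cancel]
      _ ≤ ‖x - x₀‖ + ‖x₀‖ := norm_add_le _ _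
      _ ≤ _ := by gcongr; exact norm_sub_le_of_mem_dyadicCube hx hx₀

section Weight

variable {w : R3 → ℝ}

theorem weightMeasure_eq (hw : ∀ x, 0 ≤ w x) :
    weightMeasure w = volume.withDensity fun x => ‖w x‖ₑ := by
  unfold weightMeasure
  congr 1; funext x
  rw [Real.enorm_of_nonneg (hw x)]

theorem weightMeasure_closedBall_ne_top (hw : ∀ x, 0 ≤ w x) (h : LocallyIntegrable w volume)
    (R : ℝ) : weightMeasure w (Metric.closedBall 0 R) ≠ ⊤ := by
  rw [weightMeasure_eq hw, withDensity_apply _ Metric.isClosed_closedBall.measurableSet]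
  exact (h.integrableOn_isCompact (isCompact_closedBall 0 R)).2.ne

theorem weightMeasure_dyadicCubeP_ne_top (hw : ∀ x, 0 ≤ w x) (h : LocallyIntegrable w volume)
    (q : ℤ × (Fin 3 → ℤ)) : weightMeasure w (dyadicCubeP q) ≠ ⊤ := by
  obtain ⟨R, hR⟩ := dyadicCube_subset_closedBall q.1 q.2
  exact ne_top_of_le_ne_top (weightMeasure_closedBall_ne_top hw h R) (measure_mono hR)

/-- The supremum bounds the normalised energy of each cube. Local integrability makes the mass
finite, so the inverse cancels; a null cube has no energy. -/
theorem pairEnergy_weightMeasure_le (hw : ∀ x, 0 ≤ w x) (h : LocallyIntegrable w volume)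
    (q : ℤ × (Fin 3 → ℤ)) :
    pairEnergy (weightMeasure w) (dyadicCubeP q) (dyadicCubeP q) ≤
      classFNorm w * weightMeasure w (dyadicCubeP q) := by
  have hfin := weightMeasure_dyadicCubeP_ne_top hw h q
  rcases eq_or_ne (weightMeasure w (dyadicCubeP q)) 0 with h0 | h0
  · rw [pairEnergy, Measure.restrict_eq_zero.2 h0]; simp
  have hQ := measurableSet_dyadicCubeP q
  have hwm : AEMeasurable (fun x => ‖w x‖ₑ) (volume.restrict (dyadicCubeP q)) :=
    h.aestronglyMeasurable.enorm.restrict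
  have hμ : weightMeasure w (dyadicCubeP q) = ∫⁻ x in dyadicCube q.1 q.2, ‖w x‖ₑ := by
    rw [weightMeasure_eq hw, withDensity_apply _ hQ]; rfl
  have hE : pairEnergy (weightMeasure w) (dyadicCubeP q) (dyadicCubeP q) =
      ∫⁻ x in dyadicCube q.1 q.2, ∫⁻ y in dyadicCube q.1 q.2,
        ‖w x‖ₑ * ‖w y‖ₑ / ‖x - y‖ₑ := by
    rw [pairEnergy, weightMeasure_eq hw, restrict_withDensity hQ,
      lintegral_withDensity_eq_lintegral_mul₀ hwm (measurable_potential _).aemeasurable]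
    refine lintegral_congr fun x => ?_
    rw [Pi.mul_apply, lintegral_withDensity_eq_lintegral_mul₀ hwm (by fun_prop),
      ← lintegral_const_mul'' _ (hwm.mul (by fun_prop))]
    refine lintegral_congr fun y => ?_
    rw [Pi.mul_apply, ENNReal.div_eq_inv_mul]
    ring
  have hle : (∫⁻ x in dyadicCube q.1 q.2, ‖w x‖ₑ)⁻¹ *
      ∫⁻ x in dyadicCube q.1 q.2, ∫⁻ y in dyadicCube q.1 q.2,
        ‖w x‖ₑ * ‖w y‖ₑ / ‖x - y‖ₑ ≤ classFNorm w :=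
    le_iSup_of_le q.1 (le_iSup_of_le q.2 le_rfl)
  rw [← hμ, ← hE] at hle
  calc _ = (weightMeasure w (dyadicCubeP q) * (weightMeasure w (dyadicCubeP q))⁻¹) *
        pairEnergy (weightMeasure w) (dyadicCubeP q) (dyadicCubeP q) := by
        rw [ENNReal.mul_inv_cancel h0 hfin, one_mul]
    _ ≤ weightMeasure w (dyadicCubeP q) * classFNorm w := by
        rw [mul_assoc]; gcongr
    _ = _ := mul_comm _ _

theorem nullSingletonClass_weightMeasure : NullSingletonClass (weightMeasure w) :=
  ⟨fun x => withDensity_absolutelyContinuous _ _ (measure_singleton x)⟩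

instance sFinite_weightMeasure : SFinite (weightMeasure w) := by
  unfold weightMeasure; infer_instance

/-- The trace inequality for weights of class `F`. -/
theorem trace_inequality_weightMeasure (hw : ∀ x, 0 ≤ w x) (hF : MemClassF w) {g : R3 → ℝ≥0∞}
    (hg : Measurable g) (hg2 : ∫⁻ x, g x ^ 2 ∂(weightMeasure w) ≠ ⊤) :
    ∫⁻ x, ∫⁻ y, g x * g y * ‖x - y‖ₑ⁻¹ ∂(weightMeasure w) ∂(weightMeasure w) ≤
      64 * neighbours.card * classFNorm w * ∫⁻ x, g x ^ 2 ∂(weightMeasure w) := by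
  have := nullSingletonClass_weightMeasure (w := w)
  have hA : ((classFNorm w).toNNReal : ℝ≥0∞) = classFNorm w :=
    ENNReal.coe_toNNReal hF.norm_lt_top.ne
  rw [← hA]
  exact trace_inequality _ (weightMeasure_dyadicCubeP_ne_top hw hF.locallyIntegrable)
    (fun q => by rw [hA]; exact pairEnergy_weightMeasure_le hw hF.locallyIntegrable q) hg hg2

end Weight

/-! ### The oscillatory kernel with amplitude `a` -/

/-- The kernel of the oscillatory integral operator. -/
noncomputable def oscKernel (lam : ℝ) (a : R3 × R3 → ℂ) (x y : R3) : ℂ :=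
  Complex.exp (Complex.I * ((lam * ‖x - y‖ : ℝ) : ℂ)) * a (x, y)

section Kernel

variable {a : R3 × R3 → ℂ}

theorem norm_oscKernel (lam : ℝ) (x y : R3) : ‖oscKernel lam a x y‖ = ‖a (x, y)‖ := by
  rw [oscKernel, norm_mul, mul_comm Complex.I, Complex.norm_exp_ofReal_mul_I, one_mul]

theorem continuous_oscKernel (ha : Continuous a) (lam : ℝ) :
    Continuous fun p : R3 × R3 => oscKernel lam a p.1 p.2 := by
  unfold oscKernel; fun_prop

theorem oscKernel_eq_zero (hsupp : ∀ x y, 2 < ‖x - y‖ → a (x, y) = 0) (lam : ℝ) (x y : R3)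
    (h : 2 < ‖x - y‖) : oscKernel lam a x y = 0 := by
  rw [oscKernel, hsupp x y h, mul_zero]

/-- The amplitude a(x,·) conj a(z,·) has sup bound M₀² and Lipschitz constant 2 M₀ M₁. For |x-z| > 4
its two factors have disjoint supports. -/
theorem enorm_oscKernel_kernel_le (ha : ContDiff ℝ 1 a) {M₀ M₁ : ℝ≥0} (h₀ : ∀ p, ‖a p‖ ≤ M₀)
    (h₁ : LipschitzWith M₁ a) (hsupp : ∀ x y, 2 < ‖x - y‖ → a (x, y) = 0) {lam : ℝ}
    (hlam : 1 ≤ |lam|) (x z : R3) :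
    ‖∫ y, oscKernel lam a x y * conj (oscKernel lam a z y)‖ₑ ≤
      ENNReal.ofReal ((56 * Real.pi * (2 * M₀ ^ 2 + 2 * Real.pi * (2 * M₀ * M₁)) + 1) / |lam|) *
        ‖x - z‖ₑ⁻¹ := by
  have hpi := Real.pi_pos
  have hl : 0 < |lam| := by linarith
  set C : ℝ := 56 * Real.pi * (2 * M₀ ^ 2 + 2 * Real.pi * (2 * M₀ * M₁)) with hC
  have hC0 : 0 ≤ C := by positivity
  have hpos : 0 < (C + 1) / |lam| := by positivity
  rcases eq_or_ne x z with rfl | hxz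
  -- The +1 in the constant matters here: on the diagonal the right side must be a positive number
  -- times ⊤, not 0 · ⊤ = 0.
  · rw [sub_self, enorm_zero, ENNReal.inv_zero, ENNReal.mul_top (by simpa using hpos)]
    exact le_top
  by_cases hr4 : ‖x - z‖ ≤ 4
  swap
  · have : ∀ y, oscKernel lam a x y * conj (oscKernel lam a z y) = 0 := by
      intro y
      by_cases h : 2 < ‖x - y‖
      · rw [oscKernel_eq_zero hsupp lam x y h, zero_mul]
      · have h' : 2 < ‖z - y‖ := by
          have : ‖x - z‖ ≤ ‖x - y‖ + ‖z - y‖ := by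
            rw [norm_sub_rev z y]
            exact norm_sub_le_norm_sub_add_norm_sub x y z
          linarith
        rw [oscKernel_eq_zero hsupp lam z y h', map_zero, mul_zero]
    simp [this]
  set c : R3 → ℂ := fun y => a (x, y) * conj (a (z, y)) with hc
  have hcd : ContDiff ℝ 1 c := by
    have h1 : ∀ x, ContDiff ℝ 1 fun y => a (x, y) := fun x =>
      ha.comp (contDiff_const.prodMk contDiff_id)
    exact (h1 x).mul (Complex.conjCLE.contDiff.comp (h1 z))
  have hc0 : ∀ y, ‖c y‖ ≤ (M₀ : ℝ) ^ 2 := fun y => by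
    rw [hc, norm_mul, RCLike.norm_conj, sq]
    exact mul_le_mul (h₀ _) (h₀ _) (norm_nonneg _) M₀.2
  have hcl : LipschitzWith (2 * M₀ * M₁) c := by
    refine LipschitzWith.of_dist_le_mul fun y y' => ?_
    have hd : ∀ x, ‖a (x, y) - a (x, y')‖ ≤ M₁ * dist y y' := fun x => by
      rw [← dist_eq_norm]
      refine (h₁.dist_le_mul _ _).trans (le_of_eq ?_)
      rw [Prod.dist_eq, dist_self, max_eq_right dist_nonneg]
    have e : c y - c y' = (a (x, y) - a (x, y')) * conj (a (z, y)) +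
        a (x, y') * conj (a (z, y) - a (z, y')) := by
      simp only [hc, map_sub]; ring
    rw [dist_eq_norm, e]
    refine (norm_add_le _ _).trans ?_
    rw [norm_mul, norm_mul, RCLike.norm_conj, RCLike.norm_conj]
    have h1 := mul_le_mul (hd x) (h₀ (z, y)) (norm_nonneg _) (by positivity)
    have h2 := mul_le_mul (h₀ (x, y')) (hd z) (norm_nonneg _) M₀.2
    push_cast
    linarith
  have hcs : ∀ y, 2 < ‖x - y‖ → c y = 0 := fun y hy => by
    rw [hc]; simp only [hsupp x y hy, zero_mul]
  have key := norm_osc_kernel_le hlam hxz hr4 hcd hc0 hcl hcs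
  have e : ∀ y, oscKernel lam a x y * conj (oscKernel lam a z y) =
      Complex.exp (Complex.I * lam * ‖x - y‖) *
        (Complex.exp (-(Complex.I * lam * ‖z - y‖)) * c y) := by
    intro y
    simp only [oscKernel, map_mul, ← Complex.exp_conj, Complex.conj_I, Complex.conj_ofReal, hc]
    push_cast
    rw [show -Complex.I * ((lam : ℂ) * ‖z - y‖) = -(Complex.I * lam * ‖z - y‖) by ring,
      show Complex.I * ((lam : ℂ) * ‖x - y‖) = Complex.I * lam * ‖x - y‖ by ring]
    ring
  simp only [e]
  have hr0 : 0 < ‖x - z‖ := norm_pos_iff.2 (sub_ne_zero.2 hxz)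
  rw [← ofReal_norm, ← ofReal_norm, ← ENNReal.ofReal_inv_of_pos hr0,
    ← ENNReal.ofReal_mul hpos.le]
  refine ENNReal.ofReal_le_ofReal (key.trans ?_)
  rw [← div_eq_mul_inv, div_div]
  gcongr
  rw [hC]
  push_cast
  linarith

theorem memLp_oscKernel (ha : Continuous a)
    (hsupp : ∀ x y, 2 < ‖x - y‖ → a (x, y) = 0) (lam : ℝ) (x : R3) :
    MemLp (oscKernel lam a x) 2 volume := by
  have hc : Continuous (oscKernel lam a x) := by unfold oscKernel; fun_prop
  refine hc.memLp_of_hasCompactSupport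
    (HasCompactSupport.intro (isCompact_closedBall x 2) fun y hy => ?_)
  refine oscKernel_eq_zero hsupp lam x y ?_
  rw [Metric.mem_closedBall, dist_comm, dist_eq_norm, not_le] at hy
  exact hy

theorem eLpNorm_two_sq {f : R3 → ℂ} (ν : Measure R3) :
    eLpNorm f 2 ν = (∫⁻ x, ‖f x‖ₑ ^ 2 ∂ν) ^ (1 / 2 : ℝ) := by
  rw [eLpNorm_eq_lintegral_rpow_enorm_toReal two_ne_zero ENNReal.ofNat_ne_top]
  simp

end Kernel

theorem lemma5p1 (a : R3 × R3 → ℂ) (ha : ContDiff ℝ ∞ a)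
    (ha_bdd : ∀ n : ℕ, ∃ M : ℝ, ∀ p : R3 × R3, ‖iteratedFDeriv ℝ n a p‖ ≤ M)
    (ha_supp : tsupport a ⊆ {p | 1 / 2 ≤ ‖p.1 - p.2‖ ∧ ‖p.1 - p.2‖ ≤ 2}) :
    ∃ C : ℝ≥0, ∀ w : R3 → ℝ, (∀ x, 0 ≤ w x) → MemClassF w →
      ∀ f : R3 → ℂ, MemLp f 2 volume → ∀ lam : ℝ, 1 ≤ |lam| →
        (∀ x, Integrable (oscIntegrand lam a f x) volume) ∧
        MemLp (oscIntegral lam a f) 2 (weightMeasure w) ∧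
        eLpNorm (oscIntegral lam a f) 2 (weightMeasure w) ≤
          (C : ℝ≥0∞) * ENNReal.ofReal (|lam| ^ (-(1 / 2) : ℝ)) *
            classFNorm w ^ (1 / 2 : ℝ) * eLpNorm f 2 volume := by
  obtain ⟨M₀, h₀⟩ : ∃ M₀ : ℝ≥0, ∀ p, ‖a p‖ ≤ M₀ := by
    obtain ⟨M, hM⟩ := ha_bdd 0
    simp only [norm_iteratedFDeriv_zero] at hM
    exact ⟨⟨M, (norm_nonneg _).trans (hM 0)⟩, hM⟩
  have ha1 : ContDiff ℝ 1 a := ha.of_le (by exact_mod_cast le_top)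
  obtain ⟨M₁, h₁⟩ : ∃ M₁ : ℝ≥0, LipschitzWith M₁ a := by
    obtain ⟨M, hM⟩ := ha_bdd 1
    simp only [norm_iteratedFDeriv_one] at hM
    exact ⟨⟨M, (norm_nonneg _).trans (hM 0)⟩,
      lipschitzWith_of_nnnorm_fderiv_le (ha1.differentiable one_ne_zero) hM⟩
  have hsupp : ∀ x y, 2 < ‖x - y‖ → a (x, y) = 0 := fun x y hxy => by
    by_contra h
    exact not_lt.2 (ha_supp (subset_tsupport a h)).2 hxy
  set C₁ : ℝ := 56 * Real.pi * (2 * M₀ ^ 2 + 2 * Real.pi * (2 * M₀ * M₁)) + 1 with hC₁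
  have hC₁0 : 0 ≤ C₁ := by have := Real.pi_pos; positivity
  -- The product of the kernel and trace constants; it bounds the squared norm, hence the square
  -- root below.
  set C₂ : ℝ≥0 := C₁.toNNReal * (64 * neighbours.card) with hC₂
  refine ⟨NNReal.sqrt C₂, fun w hw hF f hf lam hlam => ?_⟩
  have hl : 0 < |lam| := by linarith
  have hintegrable : ∀ x, Integrable (oscIntegrand lam a f x) volume := fun x =>
    (memLp_oscKernel ha.continuous hsupp lam x).integrable_mul hf
  -- A strongly measurable representative is needed for joint measurability; the oscillatory
  -- integral is unchanged at every x, so the weight plays no role.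
  set f₀ := hf.1.mk f with hf₀
  have hff₀ : f =ᵐ[volume] f₀ := hf.1.ae_eq_mk
  have hf₀2 : MemLp f₀ 2 volume := (memLp_congr_ae hff₀).1 hf
  have hosc : oscIntegral lam a f = fun x => ∫ y, oscKernel lam a x y * f₀ y := by
    funext x
    refine integral_congr_ae ?_
    filter_upwards [hff₀] with y hy
    rw [oscIntegrand, oscKernel, hy]
  have hmain := lintegral_operator_le (μ := weightMeasure w)
    (continuous_oscKernel ha.continuous lam)
    (fun x y => (norm_oscKernel lam x y).trans_le (h₀ _)) (oscKernel_eq_zero hsupp lam)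
    (enorm_oscKernel_kernel_le ha1 h₀ h₁ hsupp hlam)
    (fun g hg hg2 => trace_inequality_weightMeasure hw hF hg hg2)
    (weightMeasure_closedBall_ne_top hw hF.locallyIntegrable)
    hf.1.stronglyMeasurable_mk hf₀2
  have hbound : eLpNorm (oscIntegral lam a f) 2 (weightMeasure w) ≤
      (NNReal.sqrt C₂ : ℝ≥0∞) * ENNReal.ofReal (|lam| ^ (-(1 / 2) : ℝ)) *
        classFNorm w ^ (1 / 2 : ℝ) * eLpNorm f 2 volume := by
    rw [eLpNorm_congr_ae hff₀, eLpNorm_two_sq, eLpNorm_two_sq, hosc]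
    refine (ENNReal.rpow_le_rpow hmain (by norm_num)).trans (le_of_eq ?_)
    have hhalf : (0 : ℝ) ≤ 1 / 2 := by norm_num
    have e1 : ENNReal.ofReal (C₁ / |lam|) * (64 * neighbours.card * classFNorm w) =
        (C₂ : ℝ≥0∞) * ENNReal.ofReal |lam|⁻¹ * classFNorm w := by
      rw [div_eq_mul_inv, ENNReal.ofReal_mul hC₁0, hC₂]
      push_cast
      rw [ENNReal.ofReal]
      ring
    have e2 : (C₂ : ℝ≥0∞) ^ (1 / 2 : ℝ) = (NNReal.sqrt C₂ : ℝ≥0∞) := by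
      rw [NNReal.sqrt_eq_rpow, ENNReal.coe_rpow_of_nonneg _ hhalf]
    have e3 : ENNReal.ofReal |lam|⁻¹ ^ (1 / 2 : ℝ) = ENNReal.ofReal (|lam| ^ (-(1 / 2) : ℝ)) := by
      rw [ENNReal.ofReal_rpow_of_nonneg (by positivity) hhalf, Real.inv_rpow hl.le,
        Real.rpow_neg hl.le]
    rw [e1, ENNReal.mul_rpow_of_nonneg _ _ hhalf, ENNReal.mul_rpow_of_nonneg _ _ hhalf,
      ENNReal.mul_rpow_of_nonneg _ _ hhalf, e2, e3]
  refine ⟨hintegrable, ⟨?_, ?_⟩, hbound⟩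
  · rw [hosc]
    refine (StronglyMeasurable.integral_prod_right'
      (f := fun p : R3 × R3 => oscKernel lam a p.1 p.2 * f₀ p.2) ?_).aestronglyMeasurable
    exact ((continuous_oscKernel ha.continuous lam).measurable.mul
      (hf.1.stronglyMeasurable_mk.measurable.comp measurable_snd)).stronglyMeasurable
  · refine hbound.trans_lt ?_
    refine ENNReal.mul_lt_top (ENNReal.mul_lt_top (ENNReal.mul_lt_top ENNReal.coe_lt_top
      ENNReal.ofReal_lt_top) ?_) hf.2
    exact ENNReal.rpow_lt_top_of_nonneg (by norm_num) hF.norm_lt_top.ne
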